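/- Conventions (positive logic). A formula is positive if it is built from atomic formulas using $\top,\bot,\wedge,\vee,\exists$; a theory $T$ is a set of sentences $\forall x(\varphi(x)\to\psi(x))$ with $\varphi,\psi$ positive. A model of $T$ is existentially closed (e.c.) if every homomorphism from it to a model of $T$ preserves and reflects positive formulas. All types are sets of positive formulas, and $\operatorname{tp}(a/C)$ is the set of all positive formulas over $C$ satisfied by $a$; $a\equiv_C b$ means $\operatorname{tp}(a/C)=\operatorname{tp}(b/C)$. We work in a monster model $\mathfrak M$ of $T$: an e.c. model that is saturated and strongly homogeneous (for positive formulas) with respect to small sets and tuples, where small means of cardinality $<\kappa$ for a cardinal $\kappa>|L|+\aleph_0$ that is closed under $\mu\mapsto\beth_{(2^\mu)^+}$. Global types are the types over $\mathfrak M$ of tuples of a bigger monster $\mathfrak M'$ in which $\mathfrak M$ is small. A sequence $(a_i)_{i<\omega}$ is $C$-indiscernible if $a_{i_1}\cdots a_{i_n}\equiv_C a_{j_1}\cdots a_{j_n}$ for all $i_1<\dots<i_n$ and $j_1<\dots<j_n$. We write $a\equiv^{\mathrm{Ls}}_C b$ if there are $n<\omega$ and $a=c_0,\dots,c_n=b$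 such that $c_k$ and $c_{k+1}$ are on a common $C$-indiscernible sequence for all $k<n$. $T$ is thick if indiscernibility of sequences $(x_i)_{i<\omega}$ of tuples (equivalently, of finite tuples) is definable by a partial positive type over $\emptyset$. For sets $M\subseteq N$, $a$ is $M$-Ls-invariant over $N$ if $b\equiv^{\mathrm{Ls}}_M b'$ implies $ab\equiv^{\mathrm{Ls}}_M ab'$ for all tuples $b,b'$ in $N$; a global type $\operatorname{tp}(\alpha/\mathfrak M)$ is $M$-Ls-invariant if $\alpha$ is $M$-Ls-invariant over $\mathfrak M$. For a global $M$-Ls-invariant type $q$, $(\alpha_i)_{i<\omega}\models q^{\otimes\omega}$ means that for every $i$, $\alpha_i\models q$ and $\alpha_i$ is $M$-Ls-invariant over $\mathfrak M\alpha_{<i}$; a Morley sequence in $q$ over $M$ is a sequence $(a_i)_{i<\omega}$ in $\mathfrak M$ with $(a_i)_{i<\omega}\equiv^{\mathrm{Ls}}_M(\alpha_i)_{i<\omega}$ for some such $(\alpha_i)_{i<\omega}$. Trees. For an ordinal $\alpha$, $\mathcal T_\alpha$ is the set of functions $\eta:[\beta,\alpha)\to\omega$ with finite support, where $\beta\le\alpha$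 is $0$ or a successor. Here $\eta\trianglelefteq\nu$ means $\eta\subseteq\nu$; $\eta\wedge\nu$ is the largest common restriction of $\eta$ and $\nu$ to a final segment; $\eta<_{\mathrm{lex}}\nu$ means that $\eta\subsetneq\nu$, or that $\eta,\nu$ are $\trianglelefteq$-incomparable, $\operatorname{dom}(\eta\wedge\nu)=[\gamma+1,\alpha)$ and $\eta(\gamma)<\nu(\gamma)$; $\eta<_{\mathrm{len}}\nu$ means $\operatorname{dom}(\eta)\subsetneq\operatorname{dom}(\nu)$; and $P_\beta(\eta)$ means $\operatorname{dom}(\eta)=[\beta,\alpha)$. The s-language consists of $\trianglelefteq,\wedge,<_{\mathrm{lex}}$ and $P_\beta$ for $\beta\le\alpha$; the str-language consists of $\trianglelefteq,\wedge,<_{\mathrm{lex}},<_{\mathrm{len}}$. Let $(a_\eta)_{\eta\in\mathcal T_\alpha}$ be a tree of small tuples of a fixed length in $\mathfrak M$. It is s-indiscernible over $M$ if $a_{\bar\eta}\equiv_M a_{\bar\nu}$ for all finite tuples $\bar\eta,\bar\nu$ in $\mathcal T_\alpha$ with the same quantifier-free s-type. For $\operatorname{dom}(\eta)=[\beta+1,\alpha)$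 and $i<\omega$, let $\eta^\frown\langle i\rangle=\eta\cup\{(\beta,i)\}$, and let $a_{\trianglerighteq\eta^\frown\langle i\rangle}$ be the tuple of all $a_\nu$ with $\nu\in\mathcal T_\alpha$ and $\nu\supseteq\eta^\frown\langle i\rangle$, indexed by $\nu|_\beta\in\mathcal T_\beta$. The tree is spread out over $M$ if for every $\eta\in\mathcal T_\alpha$ with $\operatorname{dom}(\eta)=[\beta+1,\alpha)$ for some $\beta<\alpha$ there is a global $M$-Ls-invariant type $q_\eta\supseteq\operatorname{tp}(a_{\trianglerighteq\eta^\frown\langle 0\rangle}/M)$ such that $(a_{\trianglerighteq\eta^\frown\langle i\rangle})_{i<\omega}$ is a Morley sequence in $q_\eta$ over $M$. A tree $(b_\eta)_{\eta\in\mathcal T_\omega}$ is str-based on $(a_\eta)_{\eta\in\mathcal T_\alpha}$ over $M$ if for every finite tuple $\bar\eta$ in $\mathcal T_\omega$ there is a tuple $\bar\nu$ in $\mathcal T_\alpha$ with the same quantifier-free str-type and $b_{\bar\eta}\equiv_M a_{\bar\nu}$. Lemma. Let $T$ be a thick theory, let $M\subseteq\mathfrak M$ be a small e.c. model of $T$ and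 let $\alpha$ be a small ordinal. Suppose that $(a_\eta)_{\eta\in\mathcal T_\alpha}$ is s-indiscernible over $M$ and spread out over $M$, and that $(b_\eta)_{\eta\in\mathcal T_\omega}$ is str-based on $(a_\eta)_{\eta\in\mathcal T_\alpha}$ over $M$. Then $(b_\eta)_{\eta\in\mathcal T_\omega}$ is spread out over $M$. -/

import Mathlib

open FirstOrder Cardinal

universe u v w

namespace PosLogic

/-! ### Positive logic -/

section Positive

variable {L : FirstOrder.Language.{u, u}}

/-- Positive (existential) formulas: built from atomic formulas with `⊤, ⊥, ∧, ∨, ∃`. -/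
inductive IsPositive {V : Type w} : ∀ {n : ℕ}, L.BoundedFormula V n → Prop
  | atomic {n : ℕ} {φ : L.BoundedFormula V n} (h : φ.IsAtomic) : IsPositive φ
  | top {n : ℕ} : IsPositive (⊤ : L.BoundedFormula V n)
  | bot {n : ℕ} : IsPositive (⊥ : L.BoundedFormula V n)
  | inf {n : ℕ} {φ ψ : L.BoundedFormula V n} (h₁ : IsPositive φ) (h₂ : IsPositive ψ) :
      IsPositive (φ ⊓ ψ)
  | sup {n : ℕ} {φ ψ : L.BoundedFormula V n} (h₁ : IsPositive φ) (h₂ : IsPositive ψ) :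
      IsPositive (φ ⊔ ψ)
  | ex {n : ℕ} {φ : L.BoundedFormula V (n + 1)} (h : IsPositive φ) : IsPositive φ.ex

/-- A positive (h-inductive) theory: a set of sentences `∀ x, φ(x) → ψ(x)` with `φ, ψ` positive. -/
def IsPositiveTheory (T : L.Theory) : Prop :=
  ∀ σ ∈ T, ∃ (n : ℕ) (φ ψ : L.BoundedFormula Empty n),
    IsPositive φ ∧ IsPositive ψ ∧ σ = (φ.imp ψ).alls

/-- Immersions: homomorphisms that preserve and reflect positive formulas. -/
def IsImmersion {A B : Type u} [L.Structure A] [L.Structure B] (f : A →[L] B) : Prop :=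
  ∀ (n : ℕ) (φ : L.Formula (Fin n)), IsPositive φ →
    ∀ x : Fin n → A, φ.Realize (fun i => f (x i)) ↔ φ.Realize x

/-- Existentially closed models: every homomorphism into a model is an immersion. -/
def IsECModel (T : L.Theory) (A : Type u) [L.Structure A] : Prop :=
  A ⊨ T ∧ ∀ (B : Type u) [L.Structure B], B ⊨ T → ∀ f : A →[L] B, IsImmersion f

/-- The type `tp(a / C)`, as a set of positive formulas in the variables of `a` and with
parameters from `C`. -/
def tp {U : Type u} [L.Structure U] (C : Set U) {V : Type w} (a : V → U) :
    Set (L.Formula (V ⊕ C)) :=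
  {φ | IsPositive φ ∧ φ.Realize (Sum.elim a (fun c => (c : U)))}

/-- `a ≡_C b`. -/
def EqType (L : FirstOrder.Language.{u, u}) {U : Type u} [L.Structure U] (C : Set U) {V : Type w}
    (a b : V → U) : Prop :=
  tp (L := L) C a = tp C b

/-- A monster model of `T`, where "small" means of cardinality `< κ`: an e.c. model that is
saturated for small sets of positive formulas (in small many variables and with small many
parameters) and strongly homogeneous for small tuples.  The cardinal `κ` is large: it is bigger
than `|L| + ℵ₀` and closed under `μ ↦ ℶ_{(2^μ)⁺}`. -/
structure IsMonster (T : L.Theory) (U : Type u) [L.Structure U] (κ : Cardinal.{u}) : Prop where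
  ec : IsECModel T U
  language_lt : max ℵ₀ L.card < κ
  beth_lt : ∀ μ < κ, beth (Order.succ ((2 : Cardinal.{u}) ^ μ)).ord < κ
  saturated : ∀ (V : Type u) (C : Set U), #V < κ → #C < κ →
    ∀ Γ : Set (L.Formula (V ⊕ C)), (∀ φ ∈ Γ, IsPositive φ) →
      (∀ Γ₀ : Finset (L.Formula (V ⊕ C)), (Γ₀ : Set (L.Formula (V ⊕ C))) ⊆ Γ →
        ∃ a : V → U, ∀ φ ∈ Γ₀, φ.Realize (Sum.elim a (fun c => (c : U)))) →
      ∃ a : V → U, ∀ φ ∈ Γ, φ.Realize (Sum.elim a (fun c => (c : U)))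
  homogeneous : ∀ V : Type u, #V < κ → ∀ a b : V → U, EqType L ∅ a b →
    ∃ f : U ≃[L] U, ∀ i, f (a i) = b i

/-! ### Indiscernible sequences, Lascar strong types, thickness -/

/-- The sequence of tuples `(a_i)_{i < ω}` is `C`-indiscernible. -/
def IsIndiscernible (L : FirstOrder.Language.{u, u}) {U : Type u} [L.Structure U] (C : Set U) {V : Type w}
    (a : ℕ → V → U) : Prop :=
  ∀ (n : ℕ) (i j : Fin n → ℕ), StrictMono i → StrictMono j →
    EqType L C (fun p : Fin n × V => a (i p.1) p.2) (fun p : Fin n × V => a (j p.1) p.2)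

/-- `d_C(a, b) ≤ n`: there are `a = c_0, …, c_n = b` such that `c_k` and `c_{k+1}` are on a
`C`-indiscernible sequence for all `k < n`. -/
def DistLE (L : FirstOrder.Language.{u, u}) {U : Type u} [L.Structure U] (C : Set U) {V : Type w}
    (n : ℕ) (a b : V → U) : Prop :=
  ∃ c : ℕ → V → U, c 0 = a ∧ c n = b ∧ ∀ k < n,
    ∃ s : ℕ → V → U, IsIndiscernible L C s ∧ (∃ i, s i = c k) ∧ ∃ j, s j = c (k + 1)

/-- `a` and `b` have the same Lascar strong type over `C`. -/
def LascarEq (L : FirstOrder.Language.{u, u}) {U : Type u} [L.Structure U] (C : Set U) {V : Type w}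
    (a b : V → U) : Prop :=
  ∃ n : ℕ, DistLE L C n a b

/-- Thickness, evaluated in the monster `U`: for sequences of finite tuples, being indiscernible
(over `∅`) is definable by a partial positive type without parameters. -/
def IsThick (L : FirstOrder.Language.{u, u}) (U : Type u) [L.Structure U] : Prop :=
  ∀ m : ℕ, ∃ Θ : Set (L.Formula (ℕ × Fin m)), (∀ φ ∈ Θ, IsPositive φ) ∧
    ∀ a : ℕ → Fin m → U,
      (∀ φ ∈ Θ, φ.Realize (fun p : ℕ × Fin m => a p.1 p.2)) ↔ IsIndiscernible L ∅ a

/-- `Lstp(a / N)` is `M`-Ls-invariant: for all tuples `b, b'` in `N` with `b ≡^Ls_M b'` we have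
`a b ≡^Ls_M a b'`. -/
def IsLsInvariant (L : FirstOrder.Language.{u, u}) {U : Type u} [L.Structure U] (M N : Set U) {V : Type w}
    (a : V → U) : Prop :=
  ∀ (W : Type u) (b b' : W → U), (∀ i, b i ∈ N) → (∀ i, b' i ∈ N) → LascarEq L M b b' →
    LascarEq L M (Sum.elim a b) (Sum.elim a b')

/-! ### Global types and Morley sequences

The monster `U` sits inside a bigger monster `U'` through `j : U →[L] U'`.  Global types are the
types over (the image of) `U` of tuples in `U'`. -/

variable {U U' : Type u} [L.Structure U] [L.Structure U']

/-- `q` is a global `M`-Ls-invariant type. -/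
def IsGlobalLsInvariant (j : U →[L] U') (M : Set U) {V : Type w}
    (q : Set (L.Formula (V ⊕ Set.range j))) : Prop :=
  ∃ α : V → U', tp (Set.range j) α = q ∧ IsLsInvariant L (j '' M) (Set.range j) α

/-- `(α_i)_{i < ω} ⊨ q^{⊗ω}`: every `α_i` realises the extension of the global `M`-Ls-invariant
type `q` to an `M`-Ls-invariant type over `U α_{<i}`. -/
def RealizesTensorPower (j : U →[L] U') (M : Set U) {V : Type w}
    (q : Set (L.Formula (V ⊕ Set.range j))) (α : ℕ → V → U') : Prop :=
  ∀ i, tp (Set.range j) (α i) = q ∧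
    IsLsInvariant L (j '' M) (Set.range j ∪ {x | ∃ k < i, ∃ y, α k y = x}) (α i)

/-- `(a_i)_{i < ω}` is a Morley sequence in the global `M`-Ls-invariant type `q` over `M`:
`(a_i)_{i < ω} ≡^Ls_M (α_i)_{i < ω}` for some `(α_i)_{i < ω} ⊨ q^{⊗ω}`. -/
def IsMorleySequence (j : U →[L] U') (M : Set U) {V : Type w}
    (q : Set (L.Formula (V ⊕ Set.range j))) (a : ℕ → V → U) : Prop :=
  ∃ α : ℕ → V → U', RealizesTensorPower j M q α ∧
    LascarEq L (j '' M) (fun p : ℕ × V => j (a p.1 p.2)) (fun p : ℕ × V => α p.1 p.2)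

end Positive

/-! ### The ill-founded trees -/

/-- The tree `𝒯_α`: functions `η : [β, α) → ω` with finite support, where `β ≤ α` is `0` or a
successor ordinal.  Such a function is given by `level = β` and by its extension by zero `val`. -/
@[ext]
structure Node (α : Ordinal.{u}) where
  level : Ordinal.{u}
  val : Ordinal.{u} →₀ ℕ
  level_le : level ≤ α
  not_limit : ¬ Order.IsSuccLimit level
  mem_Ico : ∀ γ, val γ ≠ 0 → level ≤ γ ∧ γ < α

namespace Node

variable {α : Ordinal.{u}}

/-- `η ⊴ ν`: the function `ν` extends the function `η`. -/
def Le (η ν : Node α) : Prop :=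
  ν.level ≤ η.level ∧ ∀ γ, η.level ≤ γ → η.val γ = ν.val γ

/-- The ordinals in the domains of both `η` and `ν` at which they differ. -/
noncomputable def diffs (η ν : Node α) : Finset Ordinal.{u} :=
  open Classical in
  (η.val.support ∪ ν.val.support).filter
    (fun γ => max η.level ν.level ≤ γ ∧ η.val γ ≠ ν.val γ)

/-- The least `β` such that `[β, α)` is contained in both domains and `η, ν` agree on `[β, α)`. -/
noncomputable def meetLevel (η ν : Node α) : Ordinal.{u} :=
  max (max η.level ν.level) ((diffs η ν).sup Order.succ)

theorem not_isSuccLimit_max {a b : Ordinal.{u}} (ha : ¬ Order.IsSuccLimit a)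
    (hb : ¬ Order.IsSuccLimit b) : ¬ Order.IsSuccLimit (max a b) := by
  rcases max_choice a b with h | h <;> rwa [h]

/-- `η ∧ ν`: the largest common restriction `η|[β, α) = ν|[β, α)`. -/
noncomputable def meet (η ν : Node α) : Node α where
  level := meetLevel η ν
  val := open Classical in η.val.filter (fun γ => meetLevel η ν ≤ γ)
  level_le := by
    refine max_le (max_le η.level_le ν.level_le) (Finset.sup_le fun γ hγ => ?_)
    simp only [diffs, Finset.mem_filter, Finset.mem_union, Finsupp.mem_support_iff] at hγ
    rcases hγ.1 with h | h
    · exact Order.succ_le_of_lt (η.mem_Ico γ h).2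
    · exact Order.succ_le_of_lt (ν.mem_Ico γ h).2
  not_limit := by
    refine not_isSuccLimit_max (not_isSuccLimit_max η.not_limit ν.not_limit) ?_
    refine Finset.sup_induction (p := fun a : Ordinal.{u} => ¬ Order.IsSuccLimit a) ?_
      (fun a ha b hb => not_isSuccLimit_max ha hb) (fun γ _ => Order.not_isSuccLimit_succ γ)
    exact Order.not_isSuccLimit_bot
  mem_Ico := by
    classical
    intro γ h
    rw [Finsupp.filter_apply] at h
    split_ifs at h with h'
    · exact ⟨h', (η.mem_Ico γ h).2⟩
    · exact absurd rfl h

/-- `η <_lex ν`: `η ◁ ν`, or `η, ν` are incomparable, `dom(η ∧ ν) = [γ + 1, α)` and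
`η(γ) < ν(γ)`. -/
def Lex (η ν : Node α) : Prop :=
  (Le η ν ∧ η ≠ ν) ∨
    (¬ Le η ν ∧ ¬ Le ν η ∧ ∃ γ, (meet η ν).level = Order.succ γ ∧ η.val γ < ν.val γ)

/-- `η <_len ν`: the domain of `η` is strictly contained in that of `ν`. -/
def Len (η ν : Node α) : Prop :=
  ν.level < η.level

/-- For `dom(η) = [β + 1, α)`, `i < ω` and `ξ ∈ 𝒯_β`, the node `η⌢⟨i⟩⌢ξ = η ∪ {(β, i)} ∪ ξ`.
As `ξ` varies over `𝒯_β`, this enumerates the nodes in `𝒯_α` that extend the function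
`η⌢⟨i⟩ = η ∪ {(β, i)}`. -/
noncomputable def graft {β : Ordinal.{u}} (η : Node α) (hη : η.level = Order.succ β) (i : ℕ)
    (ξ : Node β) : Node α where
  level := ξ.level
  val := η.val + Finsupp.single β i + ξ.val
  level_le := ξ.level_le.trans ((Order.le_succ β).trans (hη ▸ η.level_le))
  not_limit := ξ.not_limit
  mem_Ico := by
    intro γ h
    have hβ : β < α := lt_of_lt_of_le (Order.lt_succ β) (hη ▸ η.level_le)
    by_cases h₁ : η.val γ = 0
    · by_cases h₂ : ξ.val γ = 0
      · have h₃ : γ = β := by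
          by_contra hne
          exact h (by simp [h₁, h₂, Ne.symm hne])
        exact ⟨h₃ ▸ ξ.level_le, h₃ ▸ hβ⟩
      · exact ⟨(ξ.mem_Ico γ h₂).1, (ξ.mem_Ico γ h₂).2.trans hβ⟩
    · refine ⟨?_, (η.mem_Ico γ h₁).2⟩
      exact ξ.level_le.trans ((Order.le_succ β).trans (hη ▸ (η.mem_Ico γ h₁).1))

end Node

/-- The function symbol `∧` of the tree languages. -/
inductive TreeFunc : ℕ → Type
  | meet : TreeFunc 2

/-- The relation symbols `⊴, <_lex, <_len`. -/
inductive StrRel : ℕ → Type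
  | le : StrRel 2
  | lex : StrRel 2
  | len : StrRel 2

/-- The relation symbols `⊴, <_lex` and `P_β` for `β ≤ α`. -/
inductive SRel (α : Ordinal.{u}) : ℕ → Type (u + 1)
  | le : SRel α 2
  | lex : SRel α 2
  | level (β : Set.Iic α) : SRel α 1

/-- The str-language `{⊴, ∧, <_lex, <_len}`. -/
def strLang : FirstOrder.Language.{0, 0} := ⟨TreeFunc, StrRel⟩

/-- The s-language `{⊴, ∧, <_lex} ∪ {P_β : β ≤ α}`. -/
def sLang (α : Ordinal.{u}) : FirstOrder.Language.{0, u + 1} := ⟨TreeFunc, SRel α⟩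

noncomputable instance strStructure (α : Ordinal.{u}) : strLang.Structure (Node α) where
  funMap := fun f => match f with
    | .meet => fun x => Node.meet (x 0) (x 1)
  RelMap := fun r => match r with
    | .le => fun x => Node.Le (x 0) (x 1)
    | .lex => fun x => Node.Lex (x 0) (x 1)
    | .len => fun x => Node.Len (x 0) (x 1)

/-- In the s-structure `𝒯_α`, the predicate `P_β` holds of the nodes with domain `[β, α)`. -/
noncomputable instance sStructure (α : Ordinal.{u}) : (sLang α).Structure (Node α) where
  funMap := fun f => match f with
    | .meet => fun x => Node.meet (x 0) (x 1)
  RelMap := fun r => match r with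
    | .le => fun x => Node.Le (x 0) (x 1)
    | .lex => fun x => Node.Lex (x 0) (x 1)
    | .level β => fun x => (x 0).level = β

/-- The finite tuples `s` and `t` have the same quantifier-free `K`-type. -/
def EqQFType (K : FirstOrder.Language.{v, w}) {A : Type*} {B : Type*} [K.Structure A] [K.Structure B] {n : ℕ}
    (s : Fin n → A) (t : Fin n → B) : Prop :=
  ∀ φ : K.Formula (Fin n), φ.IsQF → (φ.Realize s ↔ φ.Realize t)

/-! ### Trees of parameters -/

section Trees

variable {L : FirstOrder.Language.{u, u}} {U U' : Type u} [L.Structure U] [L.Structure U'] {X : Type u}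

/-- The tree of tuples `(a_η)_{η ∈ 𝒯_α}` is s-indiscernible over `C`. -/
def IsSIndiscernible (L : FirstOrder.Language.{u, u}) [L.Structure U] (C : Set U) {α : Ordinal.{u}}
    (a : Node α → X → U) : Prop :=
  ∀ (n : ℕ) (η ν : Fin n → Node α), EqQFType (sLang α) η ν →
    EqType L C (fun p : Fin n × X => a (η p.1) p.2) (fun p : Fin n × X => a (ν p.1) p.2)

/-- `(b_η)_{η ∈ 𝒯_δ}` is str-based on `(a_η)_{η ∈ 𝒯_α}` over `C`. -/
def IsStrBased (L : FirstOrder.Language.{u, u}) [L.Structure U] (C : Set U) {δ α : Ordinal.{u}}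
    (b : Node δ → X → U) (a : Node α → X → U) : Prop :=
  ∀ (n : ℕ) (η : Fin n → Node δ), ∃ ν : Fin n → Node α, EqQFType strLang η ν ∧
    EqType L C (fun p : Fin n × X => b (η p.1) p.2) (fun p : Fin n × X => a (ν p.1) p.2)

/-- The tuple `a_{⊵ η⌢⟨i⟩}`, where `dom(η) = [β + 1, α)`. -/
noncomputable def coneTuple {α β : Ordinal.{u}} (a : Node α → X → U) (η : Node α)
    (hη : η.level = Order.succ β) (i : ℕ) : Node β × X → U :=
  fun p => a (η.graft hη i p.1) p.2

/-- `(a_η)_{η ∈ 𝒯_α}` is spread out over `M`: for all `η` with `dom(η) = [β + 1, α)`, `β < α`,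
there is a global `M`-Ls-invariant type `q ⊇ tp(a_{⊵ η⌢⟨0⟩} / M)` such that
`(a_{⊵ η⌢⟨i⟩})_{i < ω}` is a Morley sequence in `q` over `M`. -/
def IsSpreadOut (j : U →[L] U') (M : Set U) {α : Ordinal.{u}} (a : Node α → X → U) : Prop :=
  ∀ (β : Ordinal.{u}) (η : Node α) (hη : η.level = Order.succ β),
    ∃ q : Set (L.Formula ((Node β × X) ⊕ Set.range j)),
      IsGlobalLsInvariant j M q ∧
      (∀ φ ∈ tp (L := L) M (coneTuple a η hη 0),
        φ.relabel (Sum.map id (fun c : M => (⟨j c, Set.mem_range_self (c : U)⟩ : Set.range j))) ∈ q) ∧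
      IsMorleySequence j M q (coneTuple a η hη)

end Trees

end PosLogic

/-!
The statement that a sequence `(b_i)` is a Morley sequence over `M`, in some global `M`-Ls-invariant
type, is shown to be a property of its finite parts, that is, of the types over `M` of the finite
subtuples of `b_{<N}` for all `N`. Finite parts of a sequence of cones of the tree `b` are then found
as finite parts of sequences of cones of the tree `a`, which are Morley sequences by hypothesis.

*Finite parts of Morley sequences.* The set `C` is the image of `M` in the bigger monster. If
`(α_i)` realises a tensor power `q^{⊗ω}` and `(c_i)` is a Morley sequence in `q`, then, for every
`N`, the sequence `c_0, …, c_{N-1}, α_N, α_{N+1}, …` is `C`-indiscernible, and `α_N` preserves the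
indiscernibility of `C`-indiscernible sequences of the monster `U` (`KeepsIndisc`). A sequence `b`
whose finite parts all have continuations with these two properties is called `LocallyMorley`. Since
automorphisms of `U` over `M` extend to the bigger monster, it suffices that the finite parts of `b`
have the types over `M` of finite parts of Morley sequences (`IsMonster.locallyMorley_of_posEq`).

*From finite parts to Morley sequences* (`LocallyMorley.exists_isMorleySequence`). In a thick theory
being locally Morley amounts to the realisation of partial positive types, so that compactness
provides a single continuation `y` of all of `b` (`LocallyMorley.exists_continuation`). The type of
`y_0` over `U` need not be visibly Ls-invariant, but keeping `C`-indiscernible sequences is a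
type-definable condition that can be transferred to larger parameter sets
(`KeepsIndisc.exists_extension`), and over a parameter set containing enough indiscernible sequences
it implies Ls-invariance (`KeepsIndisc.isLsInvariant`). Repeating this, one obtains `(α_i)` realising
a tensor power of the type of `y_0` (`KeepsIndisc.exists_tensorPower`). By induction on `r`, the
tuples `b_{<r}` and `α_{<r}` have the same Lascar strong type: `α_r` is invariant over `U α_{<r}`,
and `(b_{<r}, y_0)` and `(b_{<r}, b_r)` are subtuples of one `C`-indiscernible sequence. The whole
sequences have the same Lascar strong type too, since the distance of `b_{<r}` and `α_{<r}` is
bounded by `2` (`IsMonster.lascarEq_tensorPower`).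

*Trees* (`IsStrBased.exists_coneTuple`). Let `η` be a node of `𝒯_ω`. Finitely many nodes above `η`
lie in finitely many cones, and their branches lie in a finite set closed under meets because the
levels below that of `η` are finite in number. A str-image of this configuration in `𝒯_α` consists
of a node `ν` and of nodes above it; replacing the branches in every cone by those of the first one,
and the indices of the cones by `0, 1, 2, …`, does not change the quantifier-free s-type, for the
str-type says that corresponding nodes in distinct cones are of the same level
(`exists_fan_eqQFType`). Hence s-indiscernibility of the tree `a` turns the str-image into a finite
part of the sequence of cones above `ν`.
-/

namespace PosLogic

/-! ### Positive formulas and positive types -/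

section Formulas

variable {L : FirstOrder.Language.{u, u}}

theorem IsPositive.relabel {V : Type v} {W : Type w} {m : ℕ} (g : V → W ⊕ Fin m) {n : ℕ}
    {φ : L.BoundedFormula V n} (h : IsPositive φ) : IsPositive (φ.relabel g) := by
  induction h with
  | atomic h => exact .atomic (h.relabel g)
  | top => exact IsPositive.top
  | bot => exact IsPositive.bot
  | inf _ _ ih₁ ih₂ => exact .inf ih₁ ih₂
  | sup _ _ ih₁ ih₂ => exact .sup ih₁ ih₂
  | ex _ ih =>
    rw [FirstOrder.Language.BoundedFormula.relabel_ex]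
    exact .ex ih

theorem IsPositive.formula_relabel {V : Type v} {W : Type w} (g : V → W)
    {φ : L.Formula V} (h : IsPositive φ) : IsPositive (φ.relabel g) :=
  IsPositive.relabel (n := 0) _ h

theorem IsPositive.exs {V : Type v} {n : ℕ} {φ : L.BoundedFormula V n} (h : IsPositive φ) :
    IsPositive φ.exs := by
  induction n with
  | zero => exact h
  | succ n ih => exact ih (.ex h)

/-- A formula only depends on finitely many of its variables. -/
theorem realize_congr_freeVarFinset {V : Type v} [DecidableEq V] {A : Type w} [L.Structure A]
    (φ : L.Formula V) {a b : V → A} (h : ∀ x ∈ φ.freeVarFinset, a x = b x) :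
    φ.Realize a ↔ φ.Realize b := by
  have key (v : V → A) := FirstOrder.Language.BoundedFormula.realize_restrictFreeVar
    (φ := φ) (f := id) (v := fun x : φ.freeVarFinset => v x) (xs := default) v (fun _ => rfl)
  have hab : (fun x : φ.freeVarFinset => a x) = fun x : φ.freeVarFinset => b x :=
    funext fun x => h x x.2
  have h1 := key a
  rw [hab] at h1
  exact h1.symm.trans (key b)

/-- Positive formulas are closed under existential quantification over an arbitrary set of
variables. -/
theorem exists_closure {V : Type v} {W : Type w} (φ : L.Formula (V ⊕ W)) (hφ : IsPositive φ) :
    ∃ ψ : L.Formula V, IsPositive ψ ∧ ∀ (A : Type u) [L.Structure A] [Nonempty A] (a : V → A),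
      ψ.Realize a ↔ ∃ w : W → A, φ.Realize (Sum.elim a w) := by
  classical
  set F : Finset W := φ.freeVarFinset.preimage Sum.inr Sum.inr_injective.injOn with hF
  let e := F.equivFin
  let g : V ⊕ W → V ⊕ Fin (F.card + 1) := Sum.elim Sum.inl
    fun w => Sum.inr (if h : w ∈ F then (e ⟨w, h⟩).castSucc else Fin.last _)
  refine ⟨(FirstOrder.Language.BoundedFormula.relabel g φ).exs, (hφ.relabel g).exs, ?_⟩
  intro A _ _ a
  rw [FirstOrder.Language.BoundedFormula.realize_exs]
  have key : ∀ xs : Fin (F.card + 1 + 0) → A,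
      (FirstOrder.Language.BoundedFormula.relabel g φ).Realize a xs ↔
        φ.Realize (Sum.elim a (xs ∘ Fin.castAdd 0) ∘ g) := by
    intro xs
    rw [FirstOrder.Language.BoundedFormula.realize_relabel]
    exact iff_of_eq (congrArg _ (Subsingleton.elim _ _))
  constructor
  · rintro ⟨xs, h⟩
    refine ⟨fun w => Sum.elim a (xs ∘ Fin.castAdd 0) (g (Sum.inr w)), ?_⟩
    have := (key xs).1 h
    convert this using 1
    funext x
    rcases x with x | x <;> rfl
  · rintro ⟨w, h⟩
    let d : A := Classical.arbitrary A
    let xs : Fin (F.card + 1) → A :=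
      Fin.lastCases (motive := fun _ => A) d (fun i => w (e.symm i))
    refine ⟨xs, (key xs).2 ((realize_congr_freeVarFinset φ ?_).1 h)⟩
    rintro (x | x) hx
    · rfl
    · have hxF : x ∈ F := by rw [hF, Finset.mem_preimage]; exact hx
      change w x = xs (if h : x ∈ F then (e ⟨x, h⟩).castSucc else Fin.last _)
      rw [dif_pos hxF]
      simp [xs]

/-- A finite set of positive formulas is equivalent to a single positive formula. -/
theorem exists_finset_inf {V : Type v} (Γ : Finset (L.Formula V)) (h : ∀ φ ∈ Γ, IsPositive φ) :
    ∃ ψ : L.Formula V, IsPositive ψ ∧ ∀ (A : Type u) [L.Structure A] (a : V → A),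
      ψ.Realize a ↔ ∀ φ ∈ Γ, φ.Realize a := by
  classical
  induction Γ using Finset.induction_on with
  | empty => exact ⟨⊤, .top, fun A _ a => by simp⟩
  | insert φ Γ _ ih =>
    obtain ⟨ψ, hψ, hr⟩ := ih fun χ hχ => h χ (Finset.mem_insert_of_mem hχ)
    refine ⟨φ ⊓ ψ, .inf (h φ (Finset.mem_insert_self _ _)) hψ, fun A _ a => ?_⟩
    rw [FirstOrder.Language.Formula.realize_inf, hr]
    simp

theorem isPositive_equal {V : Type v} (s t : L.Term V) : IsPositive (s.equal t) :=
  .atomic (.equal _ _)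

theorem isPositive_rel {V : Type v} {n : ℕ} (R : L.Relations n) (ts : Fin n → L.Term V) :
    IsPositive (R.formula ts) :=
  .atomic (.rel _ _)

end Formulas

section PosEq

variable {L : FirstOrder.Language.{u, u}}

/-- The tuples `a` and `b`, possibly in different structures, satisfy the same positive
formulas. -/
def PosEq (L : FirstOrder.Language.{u, u}) {A B : Type u} [L.Structure A] [L.Structure B]
    {V : Type w} (a : V → A) (b : V → B) : Prop :=
  ∀ φ : L.Formula V, IsPositive φ → (φ.Realize a ↔ φ.Realize b)

variable {A B D : Type u} [L.Structure A] [L.Structure B] [L.Structure D] {V : Type v} {W : Type w}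

theorem PosEq.refl (a : V → A) : PosEq L a a := fun _ _ => Iff.rfl

theorem PosEq.symm {a : V → A} {b : V → B} (h : PosEq L a b) : PosEq L b a :=
  fun φ hφ => (h φ hφ).symm

theorem PosEq.trans {a : V → A} {b : V → B} {c : V → D} (h : PosEq L a b) (h' : PosEq L b c) :
    PosEq L a c :=
  fun φ hφ => (h φ hφ).trans (h' φ hφ)

theorem PosEq.comp {a : V → A} {b : V → B} (h : PosEq L a b) (g : W → V) :
    PosEq L (a ∘ g) (b ∘ g) := by
  intro φ hφ
  have := h (φ.relabel g) (hφ.formula_relabel g)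
  rwa [FirstOrder.Language.Formula.realize_relabel,
    FirstOrder.Language.Formula.realize_relabel] at this

theorem PosEq.eq_iff {a : V → A} {b : V → B} (h : PosEq L a b) (x y : V) :
    a x = a y ↔ b x = b y := by
  have := h ((FirstOrder.Language.Term.var x).equal (.var y)) (isPositive_equal _ _)
  simpa using this

/-- Positive equivalence is decided on finite subtuples. -/
theorem posEq_of_finite {a : V → A} {b : V → B}
    (h : ∀ (m : ℕ) (g : Fin m → V), PosEq L (a ∘ g) (b ∘ g)) : PosEq L a b := by
  classical
  intro φ hφ
  by_cases hV : Nonempty V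
  · let F := φ.freeVarFinset
    let e := F.equivFin
    let d : V := Classical.arbitrary V
    let g : Fin (F.card + 1) → V :=
      Fin.lastCases (motive := fun _ => V) d (fun i => (e.symm i : V))
    let r : V → Fin (F.card + 1) :=
      fun x => if h : x ∈ F then (e ⟨x, h⟩).castSucc else Fin.last _
    have hr : ∀ x ∈ F, g (r x) = x := by
      intro x hx
      simp [g, r, hx]
    have h1 := h _ g (φ.relabel r) (hφ.formula_relabel r)
    rw [FirstOrder.Language.Formula.realize_relabel,
      FirstOrder.Language.Formula.realize_relabel] at h1
    have ha := realize_congr_freeVarFinset φ (a := a) (b := (a ∘ g) ∘ r) fun x hx => by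
      simp only [Function.comp_apply, hr x hx]
    have hb := realize_congr_freeVarFinset φ (a := b) (b := (b ∘ g) ∘ r) fun x hx => by
      simp only [Function.comp_apply, hr x hx]
    exact ha.trans (h1.trans hb.symm)
  · have hV' : IsEmpty V := not_nonempty_iff.1 hV
    have h1 := (h 0 Fin.elim0).comp (W := V) (isEmptyElim : V → Fin 0)
    have h2 := h1 φ hφ
    rwa [Subsingleton.elim ((a ∘ Fin.elim0) ∘ isEmptyElim) a,
      Subsingleton.elim ((b ∘ Fin.elim0) ∘ isEmptyElim) b] at h2

theorem posEq_equiv (f : A ≃[L] B) (a : V → A) : PosEq L (fun i => f (a i)) a := by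
  intro φ _
  exact FirstOrder.Language.StrongHomClass.realize_formula f φ

theorem PosEq.map {a b : V → A} (h : PosEq L a b) (f : A ≃[L] B) :
    PosEq L (fun i => f (a i)) (fun i => f (b i)) :=
  (posEq_equiv f a).trans (h.trans (posEq_equiv f b).symm)

theorem IsImmersion.posEq {f : A →[L] B} (hf : IsImmersion f) (a : V → A) :
    PosEq L a (fun i => f (a i)) :=
  posEq_of_finite fun m g φ hφ => (hf m φ hφ (a ∘ g)).symm

theorem eqType_iff_posEq {C : Set A} {a b : V → A} :
    EqType L C a b ↔
      PosEq L (Sum.elim a (fun c : C => (c : A))) (Sum.elim b (fun c : C => (c : A))) := by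
  constructor
  · intro h φ hφ
    have := Set.ext_iff.1 h φ
    simp only [tp, Set.mem_ofPred_eq, hφ, true_and] at this
    exact this
  · intro h
    ext φ
    simp only [tp, Set.mem_ofPred_eq]
    exact and_congr_right fun hφ => h φ hφ

theorem eqType_empty_iff_posEq {a b : V → A} : EqType L ∅ a b ↔ PosEq L a b := by
  rw [eqType_iff_posEq]
  constructor
  · intro h
    exact h.comp Sum.inl
  · intro h
    have := h.comp (W := V ⊕ (∅ : Set A)) (Sum.elim id fun c => c.2.elim)
    convert this using 1 <;>
    · funext x
      rcases x with x | x
      · rfl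
      · exact x.2.elim

end PosEq

/-! ### Compactness in monster models -/

section Monster

variable {L : FirstOrder.Language.{u, u}}

/-- Compactness for formulas in an arbitrary set of variables. -/
theorem exists_model_of_finite (T : L.Theory) {V : Type u} (Γ : Set (L.Formula V))
    (h : ∀ Γ₀ : Finset (L.Formula V), (Γ₀ : Set (L.Formula V)) ⊆ Γ →
      ∃ (A : Type u) (_ : L.Structure A) (_ : Nonempty A) (a : V → A), A ⊨ T ∧
        ∀ φ ∈ Γ₀, φ.Realize a) :
    ∃ (B : Type u) (_ : L.Structure B) (b : V → B), B ⊨ T ∧ ∀ φ ∈ Γ, φ.Realize b := by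
  classical
  let Th : (L.withConstants V).Theory := (L.lhomWithConstants V).onTheory T ∪
    FirstOrder.Language.Formula.equivSentence '' Γ
  have hfin : Th.IsFinitelySatisfiable := by
    intro T₀ hT₀
    let Γ₀ : Finset (L.Formula V) :=
      (T₀.image FirstOrder.Language.Formula.equivSentence.symm).filter (· ∈ Γ)
    obtain ⟨A, _, _, a, hA, ha⟩ := h Γ₀ fun φ hφ => (Finset.mem_filter.1 hφ).2
    let _ : (FirstOrder.Language.constantsOn V).Structure A :=
      FirstOrder.Language.constantsOn.structure a
    have hmod : A ⊨ (T₀ : (L.withConstants V).Theory) := by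
      refine ⟨fun σ hσ => ?_⟩
      rcases hT₀ hσ with h1 | ⟨φ, hφ, rfl⟩
      · have h2 : A ⊨ (L.lhomWithConstants V).onTheory T :=
          (FirstOrder.Language.LHom.onTheory_model _ _).2 hA
        exact h2.realize_of_mem σ h1
      · rw [FirstOrder.Language.Formula.realize_equivSentence]
        refine ha φ (Finset.mem_filter.2 ⟨Finset.mem_image.2 ⟨_, hσ, ?_⟩, hφ⟩)
        exact Equiv.symm_apply_apply _ _
    exact FirstOrder.Language.Theory.Model.isSatisfiable A
  obtain ⟨B⟩ := FirstOrder.Language.Theory.isSatisfiable_iff_isFinitelySatisfiable.2 hfin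
  let _ : L.Structure B := (L.lhomWithConstants V).reduct B
  have : (L.lhomWithConstants V).IsExpansionOn B :=
    FirstOrder.Language.LHom.isExpansionOn_reduct _ _
  refine ⟨B, inferInstance, fun v => (L.con v : B), ?_, ?_⟩
  · refine (FirstOrder.Language.LHom.onTheory_model (L.lhomWithConstants V) T).1 ?_
    exact B.is_model.mono Set.subset_union_left
  · intro φ hφ
    rw [← FirstOrder.Language.Formula.realize_equivSentence]
    exact B.is_model.realize_of_mem _ (Or.inr ⟨φ, hφ, rfl⟩)

/-- Types of tuples in an existentially closed model are maximal among the types of tuples in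
models: the positive diagram of `A` together with a larger type would give a homomorphism from
`A` that is not an immersion. -/
theorem IsECModel.posEq_of_imp {T : L.Theory} {A B : Type u} [L.Structure A] [L.Structure B]
    [Nonempty A] [Nonempty B] (hA : IsECModel T A) (hB : B ⊨ T) {V : Type u} {a : V → A} {b : V → B}
    (h : ∀ φ : L.Formula V, IsPositive φ → φ.Realize a → φ.Realize b) : PosEq L a b := by
  classical
  intro φ hφ
  refine ⟨h φ hφ, fun hb => ?_⟩
  let Γ₁ : Set (L.Formula (V ⊕ A)) := {χ | IsPositive χ ∧ χ.Realize (Sum.elim a id)}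
  let Γ : Set (L.Formula (V ⊕ A)) := insert (φ.relabel Sum.inl) Γ₁
  obtain ⟨D, _, d, hD, hd⟩ := exists_model_of_finite T Γ (by
    intro Γ₀ hΓ₀
    obtain ⟨χ, hχ, hr⟩ := exists_finset_inf (Γ₀.filter (· ∈ Γ₁))
      (fun ψ hψ => (Finset.mem_filter.1 hψ).2.1)
    obtain ⟨ψ, hψ, hr'⟩ := exists_closure χ hχ
    have h1 : ψ.Realize a := (hr' A a).2 ⟨id, (hr A _).2 fun ψ hψ => (Finset.mem_filter.1 hψ).2.2⟩
    obtain ⟨w, hw⟩ := (hr' B b).1 (h ψ hψ h1)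
    refine ⟨B, inferInstance, inferInstance, Sum.elim b w, hB, fun θ hθ => ?_⟩
    by_cases hθ1 : θ ∈ Γ₁
    · exact (hr B _).1 hw θ (Finset.mem_filter.2 ⟨hθ, hθ1⟩)
    · rcases hΓ₀ hθ with rfl | h2
      · rw [FirstOrder.Language.Formula.realize_relabel]
        exact hb
      · exact absurd h2 hθ1)
  -- `D` satisfies the positive diagram of `A`
  let f : A →[L] D :=
    { toFun := fun x => d (Sum.inr x)
      map_fun' := fun {n} g x => by
        have := hd (((FirstOrder.Language.Term.var
            (Sum.inr (FirstOrder.Language.Structure.funMap g x))) : L.Term (V ⊕ A)).equal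
          (FirstOrder.Language.Term.func g fun i => .var (Sum.inr (x i))))
          (Or.inr ⟨isPositive_equal _ _, by simp⟩)
        simpa [Function.comp_def] using this
      map_rel' := fun {n} r x hx => by
        have := hd (r.formula fun i => .var (Sum.inr (x i)))
          (Or.inr ⟨isPositive_rel _ _, by simpa using hx⟩)
        simpa [Function.comp_def] using this }
  have hf := (hA.2 D hD f).posEq a
  refine (hf φ hφ).2 ?_
  have h1 := hd _ (Or.inl rfl)
  rw [FirstOrder.Language.Formula.realize_relabel] at h1
  convert h1 using 1
  funext v
  have := hd (((FirstOrder.Language.Term.var (Sum.inr (a v))) : L.Term (V ⊕ A)).equal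
          (FirstOrder.Language.Term.var (Sum.inl v)))
          (Or.inr ⟨isPositive_equal _ _, by simp⟩)
  have h2 : d (Sum.inr (a v)) = d (Sum.inl v) := by simpa using this
  exact h2

variable {T : L.Theory} {U U' : Type u} [L.Structure U] [L.Structure U'] {κ κ' : Cardinal.{u}}

theorem IsMonster.aleph0_lt (hU : IsMonster T U κ) : ℵ₀ < κ :=
  (le_max_left _ _).trans_lt hU.language_lt

theorem IsMonster.two_power_lt (hU : IsMonster T U κ) {μ : Cardinal.{u}} (hμ : μ < κ) :
    (2 : Cardinal.{u}) ^ μ < κ := by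
  refine lt_of_lt_of_le (Order.lt_succ _) (le_trans ?_ (hU.beth_lt μ hμ).le)
  have := Ordinal.card_le_beth (Order.succ ((2 : Cardinal.{u}) ^ μ)).ord
  rwa [Cardinal.card_ord] at this

/-- Strong homogeneity for tuples of small length. -/
theorem IsMonster.exists_equiv (hU : IsMonster T U κ) {V : Type u} (hV : #V < κ) {a b : V → U}
    (h : PosEq L a b) : ∃ f : U ≃[L] U, ∀ i, f (a i) = b i :=
  hU.homogeneous V hV a b (eqType_empty_iff_posEq.2 h)

theorem IsMonster.add_lt (hU : IsMonster T U κ) {μ ν : Cardinal.{u}} (h : μ < κ) (h' : ν < κ) :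
    μ + ν < κ :=
  Cardinal.add_lt_of_lt hU.aleph0_lt.le h h'

theorem IsMonster.mul_lt (hU : IsMonster T U κ) {μ ν : Cardinal.{u}} (h : μ < κ) (h' : ν < κ) :
    μ * ν < κ :=
  Cardinal.mul_lt_of_lt hU.aleph0_lt.le h h'

theorem IsMonster.posEq_map (hU : IsMonster T U κ) (hU' : IsMonster T U' κ') (j : U →[L] U')
    {V : Type w} (a : V → U) : PosEq L a (fun i => j (a i)) :=
  (hU.ec.2 U' hU'.ec.1 j).posEq a

/-- Small types over small subsets of `U` realised in the bigger monster are realised in `U`. -/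
theorem IsMonster.exists_posEq_map [Nonempty U] (hU : IsMonster T U κ) (hU' : IsMonster T U' κ')
    (j : U →[L] U') {V P : Type u} (hV : #V < κ) (hP : #P < κ) (a : V → U') (p : P → U) :
    ∃ a₀ : V → U, PosEq L (Sum.elim a fun i => j (p i))
      (Sum.elim (fun i => j (a₀ i)) fun i => j (p i)) := by
  classical
  have : Nonempty U' := ⟨j (Classical.arbitrary U)⟩
  have h0 : #(∅ : Set U) < κ := by
    rw [Cardinal.mk_eq_zero]
    exact Cardinal.aleph0_pos.trans hU.aleph0_lt
  -- Saturation is applied in the variables `V ⊕ P`, and the values of the variables in `P` are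
  -- then moved to `p` by homogeneity.
  let Γ : Set (L.Formula ((V ⊕ P) ⊕ (∅ : Set U))) := {φ | ∃ χ : L.Formula (V ⊕ P), IsPositive χ ∧
    χ.Realize (Sum.elim a fun i => j (p i)) ∧ φ = χ.relabel Sum.inl}
  obtain ⟨c, hc⟩ := hU.saturated (V ⊕ P) ∅ (by
      rw [Cardinal.mk_sum, Cardinal.lift_id, Cardinal.lift_id]
      exact hU.add_lt hV hP) h0 Γ
    (by rintro _ ⟨χ, h1, _, rfl⟩; exact h1.formula_relabel _) (by
      intro Γ₀ hΓ₀
      choose! χ h1 h2 h3 using fun φ (hφ : φ ∈ Γ₀) => hΓ₀ hφ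
      obtain ⟨θ, hθ, hr⟩ := exists_finset_inf (Γ₀.image χ) (by
        intro φ hφ
        obtain ⟨ψ, hψ, rfl⟩ := Finset.mem_image.1 hφ
        exact h1 ψ hψ)
      obtain ⟨ψ, hψ, hr'⟩ := exists_closure (V := Empty)
        (θ.relabel (Sum.inr : V ⊕ P → Empty ⊕ (V ⊕ P))) (hθ.formula_relabel _)
      have h4 : ψ.Realize (fun e : Empty => j (e.elim : U)) := by
        refine (hr' U' _).2 ⟨Sum.elim a fun i => j (p i), ?_⟩
        rw [FirstOrder.Language.Formula.realize_relabel]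
        refine (hr U' _).2 fun φ hφ => ?_
        obtain ⟨ψ, hψ, rfl⟩ := Finset.mem_image.1 hφ
        exact h2 ψ hψ
      have h5 := (hU.posEq_map hU' j (fun e : Empty => (e.elim : U)) ψ hψ).2 h4
      obtain ⟨w, hw⟩ := (hr' U _).1 h5
      refine ⟨w, fun φ hφ => ?_⟩
      rw [FirstOrder.Language.Formula.realize_relabel] at hw
      rw [h3 φ hφ, FirstOrder.Language.Formula.realize_relabel]
      exact (hr U _).1 hw _ (Finset.mem_image_of_mem χ hφ))
  have h6 : PosEq L (Sum.elim a fun i => j (p i)) c := by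
    refine hU'.ec.posEq_of_imp hU.ec.1 fun φ hφ h => ?_
    have := hc _ ⟨φ, hφ, h, rfl⟩
    rwa [FirstOrder.Language.Formula.realize_relabel] at this
  have h7 : PosEq L (c ∘ Sum.inr) p :=
    (h6.comp (Sum.inr : P → V ⊕ P)).symm.trans (hU.posEq_map hU' j p).symm
  obtain ⟨f, hf⟩ := hU.exists_equiv hP h7
  refine ⟨fun v => f (c (Sum.inl v)), h6.trans ?_⟩
  have h8 : PosEq L c (fun i => j (f (c i))) :=
    (posEq_equiv f c).symm.trans (hU.posEq_map hU' j _)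
  convert h8 using 1
  funext x
  rcases x with x | x
  · rfl
  · exact congrArg j (hf x).symm

/-- Automorphisms of `U` extend to the bigger monster. -/
theorem IsMonster.exists_equiv_extend (hU : IsMonster T U κ) (hU' : IsMonster T U' κ')
    (hUU' : #U < κ') (j : U →[L] U') (f : U ≃[L] U) :
    ∃ g : U' ≃[L] U', ∀ x, g (j x) = j (f x) := by
  refine hU'.exists_equiv hUU' (a := fun x => j x) (b := fun x => j (f x)) ?_
  have h := posEq_equiv f (id : U → U)
  exact (hU.posEq_map hU' j id).symm.trans (h.symm.trans (hU.posEq_map hU' j _))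

end Monster

/-! ### Lascar strong types -/

section Indiscernible

variable {L : FirstOrder.Language.{u, u}} {U U' : Type u} [L.Structure U] [L.Structure U']
  {Z : Type v} {Z' : Type w}

/-- Indiscernibility over `∅`, phrased through `PosEq`. Parameters from a set `C` are handled by
appending the constant tuple `C` to every term of the sequence. -/
def Indisc (L : FirstOrder.Language.{u, u}) {U : Type u} [L.Structure U] {Z : Type v}
    (t : ℕ → Z → U) : Prop :=
  ∀ (n : ℕ) (i j : Fin n → ℕ), StrictMono i → StrictMono j →
    PosEq L (fun p : Fin n × Z => t (i p.1) p.2) (fun p : Fin n × Z => t (j p.1) p.2)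

theorem isIndiscernible_empty_iff {a : ℕ → Z → U} :
    IsIndiscernible L ∅ a ↔ Indisc L a := by
  simp only [IsIndiscernible, Indisc, eqType_empty_iff_posEq]

theorem isIndiscernible_iff {C : Set U} {a : ℕ → Z → U} :
    IsIndiscernible L C a ↔ Indisc L fun i => Sum.elim (a i) (Subtype.val : C → U) := by
  simp only [IsIndiscernible, eqType_iff_posEq]
  constructor
  · intro h n i j hi hj
    have := (h n i j hi hj).comp (W := Fin n × (Z ⊕ C)) fun p =>
      Sum.elim (fun z => Sum.inl (p.1, z)) Sum.inr p.2
    convert this using 1 <;>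
    · funext p
      obtain ⟨p, z | c⟩ := p <;> rfl
  · intro h n i j hi hj
    rcases n with _ | n
    · rw [Subsingleton.elim i j]
      exact .refl _
    · have := (h _ i j hi hj).comp (W := (Fin (n + 1) × Z) ⊕ C) <|
        Sum.elim (fun p => (p.1, Sum.inl p.2)) fun c => (0, Sum.inr c)
      convert this using 1 <;>
      · funext p
        obtain ⟨p, z⟩ | c := p <;> rfl

theorem Indisc.comp {t : ℕ → Z → U} (h : Indisc L t) (g : Z' → Z) :
    Indisc L fun i => t i ∘ g :=
  fun n i j hi hj => (h n i j hi hj).comp fun p : Fin n × Z' => (p.1, g p.2)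

theorem indisc_of_finite {t : ℕ → Z → U}
    (h : ∀ (m : ℕ) (g : Fin m → Z), Indisc L fun i => t i ∘ g) : Indisc L t := by
  intro n i j hi hj
  refine posEq_of_finite fun m g => ?_
  exact (h m (fun k => (g k).2) n i j hi hj).comp fun k => ((g k).1, k)

theorem Indisc.posEq_of_strictMono {t : ℕ → Z → U} (h : Indisc L t) {J : Type*} [LinearOrder J]
    [Fintype J] {i j : J → ℕ} (hi : StrictMono i) (hj : StrictMono j) :
    PosEq L (fun p : J × Z => t (i p.1) p.2) (fun p : J × Z => t (j p.1) p.2) := by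
  let e := Fintype.orderIsoFinOfCardEq J rfl
  have := (h _ (i ∘ e) (j ∘ e) (hi.comp e.strictMono) (hj.comp e.strictMono)).comp
    fun p : J × Z => (e.symm p.1, p.2)
  simpa [Function.comp_def] using this

theorem Indisc.subseq {t : ℕ → Z → U} (h : Indisc L t) {e : ℕ → ℕ} (he : StrictMono e) :
    Indisc L fun i => t (e i) :=
  fun n i j hi hj => h n (e ∘ i) (e ∘ j) (he.comp hi) (he.comp hj)

/-- Consecutive increasing blocks of an indiscernible sequence form an indiscernible sequence. -/
theorem Indisc.blocks {t : ℕ → Z → U} (h : Indisc L t) {J : Type*} [LinearOrder J] [Fintype J]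
    {e : ℕ → J → ℕ} (he : ∀ k, StrictMono (e k)) (he' : ∀ k l x y, k < l → e k x < e l y) :
    Indisc L fun k (p : J × Z) => t (e k p.1) p.2 := by
  intro n i j hi hj
  have key : ∀ i : Fin n → ℕ, StrictMono i →
      StrictMono fun q : Fin n ×ₗ J => e (i (ofLex q).1) (ofLex q).2 := by
    intro i hi q r hqr
    rcases (Prod.Lex.lt_iff (x := q) (y := r)).1 hqr with h1 | ⟨h1, h2⟩
    · exact he' _ _ _ _ (hi h1)
    · change e (i (ofLex q).1) (ofLex q).2 < e (i (ofLex r).1) (ofLex r).2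
      rw [h1]
      exact he _ h2
  exact (h.posEq_of_strictMono (key i hi) (key j hj)).comp
    fun p : Fin n × J × Z => (toLex (p.1, p.2.1), p.2.2)

/-- Indiscernibility only depends on the types of the initial segments. -/
theorem Indisc.of_posEq {t : ℕ → Z → U} {t' : ℕ → Z → U'} (h : Indisc L t)
    (ht : ∀ r : ℕ, PosEq L (fun p : Fin r × Z => t p.1 p.2) (fun p : Fin r × Z => t' p.1 p.2)) :
    Indisc L t' := by
  have key : ∀ (n : ℕ) (i : Fin n → ℕ), PosEq L (fun p : Fin n × Z => t (i p.1) p.2)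
      (fun p : Fin n × Z => t' (i p.1) p.2) := by
    intro n i
    have hlt : ∀ k, i k < Finset.univ.sup i + 1 := fun k =>
      Nat.lt_succ_of_le (Finset.le_sup (Finset.mem_univ k))
    exact (ht (Finset.univ.sup i + 1)).comp fun p : Fin n × Z => (⟨i p.1, hlt p.1⟩, p.2)
  intro n i j hi hj
  exact (key n i).symm.trans ((h n i j hi hj).trans (key n j))

theorem indisc_const (a : Z → U) : Indisc L fun _ => a := fun _ _ _ _ _ => .refl _

end Indiscernible

section Lascar

variable {L : FirstOrder.Language.{u, u}} {U : Type u} [L.Structure U]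
  {V : Type v} {W : Type w} {C : Set U}

/-- Two tuples lie on a common `C`-indiscernible sequence all of whose entries are in `K`. -/
def LinkIn (L : FirstOrder.Language.{u, u}) {U : Type u} [L.Structure U] (C K : Set U)
    {V : Type w} (a b : V → U) : Prop :=
  ∃ s : ℕ → V → U, IsIndiscernible L C s ∧ (∀ k x, s k x ∈ K) ∧ (∃ i, s i = a) ∧ ∃ j, s j = b

/-- Equality of Lascar strong types is the reflexive transitive closure of lying on a common
`C`-indiscernible sequence. -/
theorem lascarEq_iff {a b : V → U} :
    LascarEq L C a b ↔ Relation.ReflTransGen (LinkIn L C Set.univ) a b := by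
  constructor
  · rintro ⟨n, c, rfl, rfl, h⟩
    induction n with
    | zero => exact .refl
    | succ n ih =>
      refine .tail (ih fun k hk => h k (hk.trans (Nat.lt_succ_self n))) ?_
      obtain ⟨s, hs, h1, h2⟩ := h n (Nat.lt_succ_self n)
      exact ⟨s, hs, fun _ _ => trivial, h1, h2⟩
  · intro h
    induction h with
    | refl => exact ⟨0, fun _ => a, rfl, rfl, fun k hk => absurd hk (Nat.not_lt_zero k)⟩
    | @tail b d _ hbd ih =>
      obtain ⟨n, c, hc0, hcn, hc⟩ := ih
      obtain ⟨s, hs, _, h1, h2⟩ := hbd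
      refine ⟨n + 1, fun k => if k ≤ n then c k else d, by simpa using hc0, by simp, ?_⟩
      intro k hk
      rcases Nat.lt_succ_iff_lt_or_eq.1 hk with hk | rfl
      · have h3 : k + 1 ≤ n := hk
        simpa [hk.le, h3] using hc k hk
      · refine ⟨s, hs, ?_, ?_⟩
        · simpa [hcn] using h1
        · simpa using h2

theorem LinkIn.mono {K K' : Set U} (h : K ⊆ K') {a b : V → U} (hl : LinkIn L C K a b) :
    LinkIn L C K' a b := by
  obtain ⟨s, hs, hK, h1, h2⟩ := hl
  exact ⟨s, hs, fun k x => h (hK k x), h1, h2⟩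

theorem LinkIn.comp {K : Set U} {a b : V → U} (hl : LinkIn L C K a b) (g : W → V) :
    LinkIn L C K (a ∘ g) (b ∘ g) := by
  obtain ⟨s, hs, hK, ⟨i, rfl⟩, ⟨j, rfl⟩⟩ := hl
  refine ⟨fun k => s k ∘ g, ?_, fun k x => hK k _, ⟨i, rfl⟩, ⟨j, rfl⟩⟩
  rw [isIndiscernible_iff] at hs ⊢
  have := hs.comp (Sum.map g id : W ⊕ C → V ⊕ C)
  simpa [Sum.elim_comp_map] using this

theorem LinkIn.symm {K : Set U} {a b : V → U} (hl : LinkIn L C K a b) : LinkIn L C K b a := by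
  obtain ⟨s, hs, hK, h1, h2⟩ := hl
  exact ⟨s, hs, hK, h2, h1⟩

theorem IsIndiscernible.map {f : U ≃[L] U} (hf : ∀ c ∈ C, f c = c) {s : ℕ → V → U}
    (hs : IsIndiscernible L C s) : IsIndiscernible L C fun k x => f (s k x) := by
  rw [isIndiscernible_iff] at hs ⊢
  intro n i j hi hj
  have := (hs n i j hi hj).map f
  convert this using 1 <;>
  · funext p
    obtain ⟨p, z | c⟩ := p
    · rfl
    · exact (hf c c.2).symm

theorem LascarEq.refl (a : V → U) : LascarEq L C a a := lascarEq_iff.2 .refl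

theorem LascarEq.trans {a b c : V → U} (h : LascarEq L C a b) (h' : LascarEq L C b c) :
    LascarEq L C a c :=
  lascarEq_iff.2 ((lascarEq_iff.1 h).trans (lascarEq_iff.1 h'))

theorem LascarEq.symm {a b : V → U} (h : LascarEq L C a b) : LascarEq L C b a :=
  have : Std.Symm (LinkIn (V := V) L C Set.univ) := ⟨fun _ _ h => h.symm⟩
  lascarEq_iff.2 (Relation.ReflTransGen.stdSymm.symm _ _ (lascarEq_iff.1 h))

theorem LascarEq.comp {a b : V → U} (h : LascarEq L C a b) (g : W → V) :
    LascarEq L C (a ∘ g) (b ∘ g) :=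
  lascarEq_iff.2 ((lascarEq_iff.1 h).lift (· ∘ g) fun _ _ h => h.comp g)

theorem LascarEq.map {a b : V → U} (h : LascarEq L C a b) {f : U ≃[L] U}
    (hf : ∀ c ∈ C, f c = c) : LascarEq L C (fun x => f (a x)) (fun x => f (b x)) := by
  refine lascarEq_iff.2 ((lascarEq_iff.1 h).lift (fun a x => f (a x)) ?_)
  rintro _ _ ⟨s, hs, _, ⟨i, rfl⟩, ⟨j, rfl⟩⟩
  exact ⟨_, hs.map hf, fun _ _ => trivial, ⟨i, rfl⟩, ⟨j, rfl⟩⟩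

theorem IsIndiscernible.posEq {s : ℕ → V → U} (hs : IsIndiscernible L C s) (i j : ℕ) :
    PosEq L (Sum.elim (s i) (Subtype.val : C → U)) (Sum.elim (s j) (Subtype.val : C → U)) := by
  rw [isIndiscernible_iff] at hs
  exact (hs 1 (fun _ => i) (fun _ => j) (Subsingleton.strictMono _)
    (Subsingleton.strictMono _)).comp fun z => (0, z)

theorem LascarEq.posEq {a b : V → U} (h : LascarEq L C a b) :
    PosEq L (Sum.elim a (Subtype.val : C → U)) (Sum.elim b (Subtype.val : C → U)) := by
  replace h := lascarEq_iff.1 h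
  induction h with
  | refl => exact .refl _
  | tail _ hl ih =>
    obtain ⟨s, hs, _, ⟨i, rfl⟩, ⟨j, rfl⟩⟩ := hl
    exact ih.trans (hs.posEq i j)

theorem IsIndiscernible.lascarEq {s : ℕ → V → U} (hs : IsIndiscernible L C s) (i j : ℕ) :
    LascarEq L C (s i) (s j) :=
  lascarEq_iff.2 (.single ⟨s, hs, fun _ _ => trivial, ⟨i, rfl⟩, ⟨j, rfl⟩⟩)

/-- Consecutive increasing blocks of a `C`-indiscernible sequence form a `C`-indiscernible
sequence. -/
theorem IsIndiscernible.blocks {s : ℕ → V → U} (hs : IsIndiscernible L C s) {J : Type*}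
    [LinearOrder J] [Fintype J] {e : ℕ → J → ℕ} (he : ∀ k, StrictMono (e k))
    (he' : ∀ k l x y, k < l → e k x < e l y) :
    IsIndiscernible L C fun k (p : J × V) => s (e k p.1) p.2 := by
  rcases isEmpty_or_nonempty J with hJ | ⟨⟨x₀⟩⟩
  · rw [isIndiscernible_iff]
    have : (fun k => Sum.elim (fun p : J × V => s (e k p.1) p.2) (Subtype.val : C → U)) =
        fun _ => Sum.elim (fun p : J × V => s (e 0 p.1) p.2) (Subtype.val : C → U) := by
      funext k x
      rcases x with x | x
      · exact isEmptyElim x.1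
      · rfl
    rw [this]
    exact indisc_const _
  · rw [isIndiscernible_iff] at hs ⊢
    have := (hs.blocks he he').comp
      (Sum.elim (fun p : J × V => (p.1, Sum.inl p.2)) fun c => (x₀, Sum.inr c) :
        (J × V) ⊕ C → J × (V ⊕ C))
    convert this using 1
    funext k x
    rcases x with x | x <;> rfl

/-- Increasing subtuples of the same finite length of a `C`-indiscernible sequence have the same
Lascar strong type over `C`, as both are followed by a third one, far enough in the sequence. -/
theorem IsIndiscernible.lascarEq_of_strictMono {s : ℕ → V → U} (hs : IsIndiscernible L C s)
    {n : ℕ} {i j : Fin n → ℕ} (hi : StrictMono i) (hj : StrictMono j) :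
    LascarEq L C (fun p : Fin n × V => s (i p.1) p.2) (fun p : Fin n × V => s (j p.1) p.2) := by
  have key : ∀ (K : ℕ) (i : Fin n → ℕ), StrictMono i → (∀ x, i x < K) →
      LascarEq L C (fun p : Fin n × V => s (i p.1) p.2)
        (fun p : Fin n × V => s (K + p.1) p.2) := by
    intro K i hi hK
    have h := hs.blocks (e := fun k => match k with
      | 0 => i
      | k + 1 => fun x => K + k * n + x) (by
        rintro (_ | k)
        · exact hi
        · intro x y hxy
          exact Nat.add_lt_add_left hxy _) (by
        rintro (_ | k) (_ | l) x y hkl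
        · omega
        · have := hK x
          change i x < K + l * n + y
          omega
        · omega
        · change K + k * n + x < K + l * n + y
          have h1 : k + 1 ≤ l := by omega
          have h2 : (k + 1) * n ≤ l * n := Nat.mul_le_mul_right n h1
          have h3 := x.2
          rw [Nat.succ_mul] at h2
          omega)
    have h2 := h.lascarEq 0 1
    simpa using h2
  have hlt : ∀ (i : Fin n → ℕ) (k : Fin n), i k < Finset.univ.sup i + 1 := fun i k =>
    Nat.lt_succ_of_le (Finset.le_sup (Finset.mem_univ k))
  let K := max (Finset.univ.sup i + 1) (Finset.univ.sup j + 1)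
  exact (key K i hi fun x => (hlt i x).trans_le (le_max_left _ _)).trans
    (key K j hj fun x => (hlt j x).trans_le (le_max_right _ _)).symm

end Lascar

/-! ### Thickness and preservation of indiscernibility -/

section Compactness

variable {L : FirstOrder.Language.{u, u}} {U U' : Type u} [L.Structure U] [L.Structure U']
  {T : L.Theory} {κ κ' : Cardinal.{u}}

/-- A condition on `V`-tuples that is definable by a partial positive type over `C`. -/
def TypeDef (L : FirstOrder.Language.{u, u}) {U : Type u} [L.Structure U] (C : Set U) {V : Type w}
    (P : (V → U) → Prop) : Prop :=
  ∃ Γ : Set (L.Formula (V ⊕ C)), (∀ φ ∈ Γ, IsPositive φ) ∧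
    ∀ a, P a ↔ ∀ φ ∈ Γ, φ.Realize (Sum.elim a (fun c => (c : U)))

/-- Saturation for families of type-definable conditions. -/
theorem IsMonster.exists_of_finite (hU : IsMonster T U κ) {V : Type u} {C : Set U} (hV : #V < κ)
    (hC : #C < κ) {ι : Type w} {P : ι → (V → U) → Prop} (hP : ∀ i, TypeDef L C (P i))
    (h : ∀ s : Finset ι, ∃ a, ∀ i ∈ s, P i a) : ∃ a, ∀ i, P i a := by
  classical
  choose Γ hΓ hr using hP
  obtain ⟨a, ha⟩ := hU.saturated V C hV hC (⋃ i, Γ i)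
    (fun φ hφ => by obtain ⟨i, hi⟩ := Set.mem_iUnion.1 hφ; exact hΓ i φ hi) (by
    intro Γ₀ hΓ₀
    choose i hi using fun φ : Γ₀ => Set.mem_iUnion.1 (hΓ₀ φ.2)
    obtain ⟨a, ha⟩ := h (Finset.univ.image i)
    exact ⟨a, fun φ hφ => (hr (i ⟨φ, hφ⟩) a).1
      (ha _ (Finset.mem_image_of_mem i (Finset.mem_univ _))) φ (hi ⟨φ, hφ⟩)⟩)
  exact ⟨a, fun i => (hr i a).2 fun φ hφ => ha φ (Set.mem_iUnion.2 ⟨i, hφ⟩)⟩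

theorem typeDef_realize {C : Set U} {V : Type w} {φ : L.Formula (V ⊕ C)} (hφ : IsPositive φ) :
    TypeDef L C fun a => φ.Realize (Sum.elim a (fun c => (c : U))) :=
  ⟨{φ}, by simpa using hφ, by simp⟩

theorem IsThick.typeDef_indisc (hT : IsThick L U) {C : Set U} {V : Type w} {m : ℕ}
    (h : ℕ → Fin m → V ⊕ C) :
    TypeDef L C fun a => Indisc L fun i k => Sum.elim a (fun c : C => (c : U)) (h i k) := by
  obtain ⟨Θ, hΘ, hr⟩ := hT m
  refine ⟨(fun φ => φ.relabel fun p : ℕ × Fin m => h p.1 p.2) '' Θ, ?_, fun a => ?_⟩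
  · rintro _ ⟨φ, hφ, rfl⟩
    exact (hΘ φ hφ).formula_relabel _
  · beta_reduce
    rw [← isIndiscernible_empty_iff, ← hr, Set.forall_mem_image]
    simp only [FirstOrder.Language.Formula.realize_relabel]
    rfl

/-- Thickness, being a property of countable types over `∅`, passes to the bigger monster. -/
theorem IsThick.lift [Nonempty U] (hT : IsThick L U) (hU : IsMonster T U κ)
    (hU' : IsMonster T U' κ') (j : U →[L] U') : IsThick L U' := by
  intro m
  obtain ⟨Θ, hΘ, hr⟩ := hT m
  refine ⟨Θ, hΘ, fun a => ?_⟩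
  obtain ⟨a₀, h₀⟩ := hU.exists_posEq_map hU' j (V := ULift.{u} (ℕ × Fin m)) (P := PEmpty.{u + 1})
    ((Cardinal.mk_le_aleph0 (α := ULift.{u} (ℕ × Fin m))).trans_lt hU.aleph0_lt)
    (by rw [Cardinal.mk_eq_zero]; exact Cardinal.aleph0_pos.trans hU.aleph0_lt)
    (fun p => a p.down.1 p.down.2) PEmpty.elim
  have h1 : PosEq L (fun p : ℕ × Fin m => a p.1 p.2)
      (fun p : ℕ × Fin m => a₀ (ULift.up p)) :=
    (h₀.comp fun p => Sum.inl (ULift.up p)).trans (hU.posEq_map hU' j _).symm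
  have h2 := hr fun i k => a₀ (ULift.up (i, k))
  rw [isIndiscernible_empty_iff] at h2 ⊢
  refine (forall₂_congr fun φ hφ => h1 φ (hΘ φ hφ)).trans (h2.trans ⟨fun h => ?_, fun h => ?_⟩)
  · exact h.of_posEq fun r => h1.symm.comp fun p : Fin r × Fin m => (p.1, p.2)
  · exact h.of_posEq fun r => h1.comp fun p : Fin r × Fin m => (p.1, p.2)

end Compactness

section Invariance

variable {L : FirstOrder.Language.{u, u}} {U U' : Type u} [L.Structure U] [L.Structure U']
  {T : L.Theory} {κ κ' : Cardinal.{u}} {C N : Set U'} {V : Type v} {W : Type w}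

/-- Every `C`-indiscernible sequence of finite tuples in `N` is indiscernible over `C` and `α`.
In thick theories this is a partial positive type in `α`, and it is equivalent to
`C`-Ls-invariance if `N` is rich enough. -/
def KeepsIndisc (L : FirstOrder.Language.{u, u}) {U : Type u} [L.Structure U] (C N : Set U)
    {V : Type w} (α : V → U) : Prop :=
  ∀ (m : ℕ) (s : ℕ → Fin m → U), (∀ i k, s i k ∈ N) → IsIndiscernible L C s →
    IsIndiscernible L C fun i => Sum.elim α (s i)

/-- The defining property of `KeepsIndisc` for sequences of infinite tuples: indiscernibility is
decided on finitely many coordinates. -/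
theorem KeepsIndisc.all {α : V → U'} (h : KeepsIndisc L C N α) {s : ℕ → W → U'}
    (hN : ∀ i k, s i k ∈ N) (hs : IsIndiscernible L C s) :
    IsIndiscernible L C fun i => Sum.elim α (s i) := by
  rw [isIndiscernible_iff]
  refine indisc_of_finite fun m g => ?_
  -- the coordinates of `g` that belong to the sequence
  let F := {k : Fin m // ∃ w, g k = Sum.inl (Sum.inr w)}
  choose w hw using fun k : F => k.2
  obtain ⟨n, ⟨e⟩⟩ := Finite.exists_equiv_fin F
  have h1 := h n (fun i k => s i (w (e.symm k))) (fun i k => hN i _) (by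
    rw [isIndiscernible_iff] at hs ⊢
    have := hs.comp (Sum.map (fun k => w (e.symm k)) id : Fin n ⊕ C → W ⊕ C)
    simpa [Function.comp_def, Sum.elim_map] using this)
  rw [isIndiscernible_iff] at h1
  have h2 : ∀ k : Fin m, ∃ z : (V ⊕ Fin n) ⊕ C, ∀ i,
      Sum.elim (Sum.elim α (s i)) (Subtype.val : C → U') (g k) =
        Sum.elim (Sum.elim α fun k => s i (w (e.symm k))) (Subtype.val : C → U') z := by
    intro k
    rcases hk : g k with (v | x) | c
    · exact ⟨.inl (.inl v), fun _ => rfl⟩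
    · refine ⟨.inl (.inr (e ⟨k, x, hk⟩)), fun i => ?_⟩
      have h3 := hw ⟨k, x, hk⟩
      have h4 : x = w ⟨k, x, hk⟩ := Sum.inr_injective (Sum.inl_injective (hk.symm.trans h3))
      simp [← h4]
    · exact ⟨.inr c, fun _ => rfl⟩
  choose g' hg' using h2
  have := h1.comp g'
  convert this using 1
  funext i k
  exact hg' k i

theorem KeepsIndisc.mono {N' : Set U'} (hN : N ⊆ N') {α : V → U'} (h : KeepsIndisc L C N' α) :
    KeepsIndisc L C N α :=
  fun m s hs => h m s fun i k => hN (hs i k)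

theorem KeepsIndisc.map {α : V → U'} (h : KeepsIndisc L C N α) {f : U' ≃[L] U'}
    (hf : ∀ c ∈ C, f c = c) (hN : ∀ x ∈ N, f.symm x ∈ N) :
    KeepsIndisc L C N fun v => f (α v) := by
  intro m s hs hi
  have hf' : ∀ c ∈ C, f.symm c = c := fun c hc => by
    conv_lhs => rw [← hf c hc]
    exact f.symm_apply_apply c
  have := (h m _ (fun i k => hN _ (hs i k)) (hi.map hf')).map hf
  convert this using 1
  funext i x
  rcases x with x | x
  · rfl
  · exact (f.apply_symm_apply _).symm

/-- Increasing subtuples of a `C`-indiscernible sequence have the same Lascar strong type, so that an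
invariant tuple cannot distinguish them. -/
theorem IsLsInvariant.keepsIndisc {α : V → U'} (h : IsLsInvariant L C N α) :
    KeepsIndisc L C N α := by
  intro m s hs hi n i j hsi hsj
  rw [eqType_iff_posEq]
  have h1 := hi.lascarEq_of_strictMono hsi hsj
  have h2 := (h (ULift.{u} (Fin n × Fin m)) (fun p => s (i p.down.1) p.down.2)
    (fun p => s (j p.down.1) p.down.2) (fun _ => hs _ _) (fun _ => hs _ _)
    (h1.comp ULift.down)).posEq
  have h3 := h2.comp (W := (Fin n × (V ⊕ Fin m)) ⊕ C)
    (Sum.map (fun p => Sum.elim Sum.inl (fun k => Sum.inr (ULift.up (p.1, k))) p.2) id)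
  convert h3 using 1 <;>
  · funext x
    obtain ⟨p, v | k⟩ | c := x <;> rfl

theorem IsLsInvariant.comp {α : V → U'} (h : IsLsInvariant L C N α) (g : W → V) :
    IsLsInvariant L C N (α ∘ g) := by
  intro W' b b' hb hb' hbb'
  have := (h W' b b' hb hb' hbb').comp (Sum.map g id)
  simpa [Function.comp_def, Sum.elim_map] using this

theorem IsLsInvariant.mono {N' : Set U'} (hN : N ⊆ N') {α : V → U'}
    (h : IsLsInvariant L C N' α) : IsLsInvariant L C N α :=
  fun W b b' hb hb' => h W b b' (fun i => hN (hb i)) fun i => hN (hb' i)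

/-- An equality of Lascar strong types is witnessed by indiscernible sequences in a small set. -/
theorem exists_mk_le_linkIn {S : Type u} {a b : S → U'} (h : LascarEq L C a b) :
    ∃ K : Set U', #K ≤ max ℵ₀ #S ∧ Relation.ReflTransGen (LinkIn L C K) a b := by
  replace h := lascarEq_iff.1 h
  induction h with
  | refl => exact ⟨∅, by simp, .refl⟩
  | tail _ hl ih =>
    obtain ⟨K, hK, hr⟩ := ih
    obtain ⟨s, hs, _, h1, h2⟩ := hl
    refine ⟨K ∪ Set.range fun p : ULift.{u} ℕ × S => s p.1.down p.2, ?_, ?_⟩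
    · refine (Cardinal.mk_union_le _ _).trans (Cardinal.add_le_of_le (le_max_left _ _) hK ?_)
      refine Cardinal.mk_range_le.trans ?_
      rw [Cardinal.mk_prod, Cardinal.lift_id, Cardinal.lift_id]
      refine (Cardinal.mul_le_max _ _).trans (max_le (max_le ?_ ?_) ?_) <;> simp
    · refine .tail (hr.lift id fun _ _ h => h.mono Set.subset_union_left) ⟨s, hs, ?_, h1, h2⟩
      exact fun k x => Or.inr ⟨(ULift.up k, x), rfl⟩

/-- Every small set `N` can be enlarged to a small set in which all equalities of Lascar strong
types between tuples of `N` are witnessed. -/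
theorem IsMonster.exists_linkIn (hU' : IsMonster T U' κ') (C : Set U') (hN : #N < κ') :
    ∃ K : Set U', N ⊆ K ∧ #K < κ' ∧ ∀ (W : Type u) (b b' : W → U'), (∀ i, b i ∈ N) →
      (∀ i, b' i ∈ N) → LascarEq L C b b' → Relation.ReflTransGen (LinkIn L C K) b b' := by
  classical
  -- Tuples with the same Lascar strong type repeat entries at the same places, so a pair of them
  -- is given by a subset `S` of `N` and a map from `S` to `N`.
  have key : ∀ p : Set N × (N → N), ∃ K : Set U', #K ≤ max ℵ₀ #N ∧
      (LascarEq L C (fun x : p.1 => ((x : N) : U')) (fun x : p.1 => (p.2 x : U')) →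
        Relation.ReflTransGen (LinkIn L C K) (fun x : p.1 => ((x : N) : U'))
          (fun x : p.1 => (p.2 x : U'))) := by
    intro p
    by_cases h : LascarEq L C (fun x : p.1 => ((x : N) : U')) (fun x : p.1 => (p.2 x : U'))
    · obtain ⟨K, hK, hr⟩ := exists_mk_le_linkIn h
      exact ⟨K, hK.trans (max_le_max le_rfl (Cardinal.mk_set_le _)), fun _ => hr⟩
    · exact ⟨∅, by simp, fun h' => absurd h' h⟩
  choose K hK hr using key
  have hmax : max ℵ₀ #N < κ' := max_lt hU'.aleph0_lt hN
  refine ⟨N ∪ ⋃ p, K p, Set.subset_union_left, ?_, ?_⟩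
  · refine (Cardinal.mk_union_le _ _).trans_lt (hU'.add_lt hN ?_)
    refine (Cardinal.mk_iUnion_le _).trans_lt ?_
    refine (mul_le_mul' le_rfl (ciSup_le' hK)).trans_lt (hU'.mul_lt ?_ hmax)
    rw [Cardinal.mk_prod, Cardinal.lift_id, Cardinal.lift_id, Cardinal.mk_set]
    refine hU'.mul_lt (hU'.two_power_lt hN) ?_
    rw [← Cardinal.power_def]
    refine lt_of_le_of_lt ?_ (hU'.two_power_lt hmax)
    calc #N ^ #N ≤ (max ℵ₀ #N) ^ (max ℵ₀ #N) := by
          refine (Cardinal.power_le_power_right (le_max_right ℵ₀ #N)).trans ?_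
          exact Cardinal.power_le_power_left
            (ne_of_gt (Cardinal.aleph0_pos.trans_le (le_max_left _ _))) (le_max_right _ _)
      _ = 2 ^ (max ℵ₀ #N) := Cardinal.power_self_eq (le_max_left _ _)
  · intro W b b' hb hb' hbb'
    have hker : ∀ w w', b w = b w' → b' w = b' w' := fun w w' hw =>
      (hbb'.posEq.eq_iff (Sum.inl w) (Sum.inl w')).1 hw
    let S : Set N := {x | ∃ w, b w = x}
    choose σ hσ using fun x : S => x.2
    let h : N → N := fun x => if hx : x ∈ S then ⟨b' (σ ⟨x, hx⟩), hb' _⟩ else x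
    have hh : ∀ x : S, (h x : U') = b' (σ x) := fun x => by simp [h]
    have h1 : LascarEq L C (fun x : S => ((x : N) : U')) (fun x : S => (h x : U')) := by
      have := hbb'.comp σ
      convert this using 1
      · funext x
        exact (hσ x).symm
      · funext x
        exact hh x
    have h2 := hr (S, h) h1
    have h3 := h2.lift (· ∘ fun w => (⟨⟨b w, hb w⟩, w, rfl⟩ : S)) fun _ _ h => h.comp _
    have h4 : ((fun x : S => (h x : U')) ∘ fun w => (⟨⟨b w, hb w⟩, w, rfl⟩ : S)) = b' := by
      funext w
      exact (hh _).trans (hker _ _ (hσ _))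
    change Relation.ReflTransGen _ b
      ((fun x : S => (h x : U')) ∘ fun w => (⟨⟨b w, hb w⟩, w, rfl⟩ : S)) at h3
    rw [h4] at h3
    exact h3.lift id fun _ _ hl => hl.mono
      ((Set.subset_iUnion K (S, h)).trans Set.subset_union_right)

/-- If the equalities of Lascar strong types in `N` are witnessed by indiscernible sequences in `K`,
then a tuple that keeps the `C`-indiscernible sequences of `K` is invariant over `N`. -/
theorem KeepsIndisc.isLsInvariant {K : Set U'} {α : V → U'} (h : KeepsIndisc L C K α)
    (hK : ∀ (W : Type u) (b b' : W → U'), (∀ i, b i ∈ N) → (∀ i, b' i ∈ N) →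
      LascarEq L C b b' → Relation.ReflTransGen (LinkIn L C K) b b') :
    IsLsInvariant L C N α := by
  intro W b b' hb hb' hbb'
  refine lascarEq_iff.2 ((hK W b b' hb hb' hbb').lift (Sum.elim α) ?_)
  rintro _ _ ⟨s, hs, hsK, ⟨i, rfl⟩, ⟨j, rfl⟩⟩
  exact ⟨_, h.all hsK hs, fun _ _ => trivial, ⟨i, rfl⟩, ⟨j, rfl⟩⟩

end Invariance

/-! ### Realisations of tensor powers -/

section Splice

variable {L : FirstOrder.Language.{u, u}} {U : Type u} [L.Structure U] {V : Type v} {W : Type w}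
  {C : Set U}

/-- The sequence `x₀, …, x_{n-1}, y₀, y₁, …`. -/
def splice {A : Type*} (n : ℕ) (x y : ℕ → A) : ℕ → A :=
  fun k => if k < n then x k else y (k - n)

theorem isIndiscernible_of_finite {s : ℕ → V → U}
    (h : ∀ (m : ℕ) (g : Fin m → V ⊕ C),
      Indisc L fun i k => Sum.elim (s i) (fun c : C => (c : U)) (g k)) :
    IsIndiscernible L C s :=
  isIndiscernible_iff.2 (indisc_of_finite h)

theorem IsIndiscernible.finite {s : ℕ → V → U} (h : IsIndiscernible L C s) {m : ℕ}
    (g : Fin m → V ⊕ C) : Indisc L fun i k => Sum.elim (s i) (fun c : C => (c : U)) (g k) :=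
  (isIndiscernible_iff.1 h).comp g

/-- In a thick theory, it is a type-definable condition on `y` that `x₀, …, x_{n-1}, y₀, y₁, …`,
restricted to finitely many coordinates, is `C`-indiscernible. -/
theorem IsThick.typeDef_splice (hT : IsThick L U) {N : Set U} (hCN : C ⊆ N) (n : ℕ)
    {x : ℕ → V → U} (hx : ∀ i v, x i v ∈ N) {m : ℕ} (g : Fin m → V ⊕ C) :
    TypeDef L N fun y : ℕ × V → U => Indisc L fun i k =>
      Sum.elim (splice n x (fun t v => y (t, v)) i) (fun c : C => (c : U)) (g k) := by
  have h := hT.typeDef_indisc (C := N) (V := ℕ × V) fun i k =>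
    Sum.elim (fun v => if i < n then Sum.inr ⟨x i v, hx i v⟩ else Sum.inl (i - n, v))
      (fun c : C => Sum.inr ⟨c, hCN c.2⟩) (g k)
  convert h using 5 with y i k
  rcases g k with v | c
  · by_cases hi : i < n <;> simp [splice, hi]
  · rfl

/-- In a thick theory, it is a type-definable condition on `y` that the sequence `s`, restricted to
finitely many coordinates, remains indiscernible over `C` when coordinates of `y` are appended. -/
theorem IsThick.typeDef_append (hT : IsThick L U) {N : Set U} (hCN : C ⊆ N) (h : V → W) {n : ℕ}
    {s : ℕ → Fin n → U} (hs : ∀ i k, s i k ∈ N) {m : ℕ} (g : Fin m → (V ⊕ Fin n) ⊕ C) :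
    TypeDef L N fun y : W → U => Indisc L fun i k =>
      Sum.elim (Sum.elim (fun v => y (h v)) (s i)) (fun c : C => (c : U)) (g k) := by
  have h := hT.typeDef_indisc (C := N) (V := W) fun i k =>
    Sum.elim (Sum.elim (fun v => Sum.inl (h v)) fun x => Sum.inr ⟨s i x, hs i x⟩)
      (fun c : C => Sum.inr ⟨c, hCN c.2⟩) (g k)
  convert h using 5 with α i k
  rcases g k with (v | x) | c <;> rfl

theorem IsIndiscernible.of_lascarEq {s t : ℕ → V → U} (hs : IsIndiscernible L C s)
    (h : ∀ r : ℕ, LascarEq L C (fun p : Fin r × V => s p.1 p.2)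
      (fun p : Fin r × V => t p.1 p.2)) : IsIndiscernible L C t := by
  rw [isIndiscernible_iff] at hs ⊢
  refine hs.of_posEq fun r => ?_
  have := (h r).posEq.comp (W := Fin r × (V ⊕ C)) fun p =>
    Sum.elim (fun v => Sum.inl (p.1, v)) Sum.inr p.2
  convert this using 1 <;>
  · funext p
    obtain ⟨p, v | c⟩ := p <;> rfl

theorem IsIndiscernible.subseq {s : ℕ → V → U} (hs : IsIndiscernible L C s) {e : ℕ → ℕ}
    (he : StrictMono e) : IsIndiscernible L C fun i => s (e i) := by
  rw [isIndiscernible_iff] at hs ⊢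
  exact hs.subseq he

theorem LascarEq.snoc {r : ℕ} {x y : Fin (r + 1) → V → U}
    (h : LascarEq L C
      (Sum.elim (x (Fin.last r)) fun p : Fin r × V => x p.1.castSucc p.2)
      (Sum.elim (y (Fin.last r)) fun p : Fin r × V => y p.1.castSucc p.2)) :
    LascarEq L C (fun p : Fin (r + 1) × V => x p.1 p.2) (fun p : Fin (r + 1) × V => y p.1 p.2) := by
  have := h.comp (W := Fin (r + 1) × V) fun p =>
    Fin.lastCases (motive := fun _ => V ⊕ Fin r × V) (Sum.inl p.2) (fun q => Sum.inr (q, p.2)) p.1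
  convert this using 1 <;>
  · funext p
    obtain ⟨p, v⟩ := p
    refine Fin.lastCases ?_ (fun q => ?_) p <;> simp

theorem LascarEq.unsnoc {r : ℕ} {x y : Fin (r + 1) → V → U}
    (h : LascarEq L C (fun p : Fin (r + 1) × V => x p.1 p.2)
      (fun p : Fin (r + 1) × V => y p.1 p.2)) :
    LascarEq L C
      (Sum.elim (x (Fin.last r)) fun p : Fin r × V => x p.1.castSucc p.2)
      (Sum.elim (y (Fin.last r)) fun p : Fin r × V => y p.1.castSucc p.2) := by
  have := h.comp (W := V ⊕ Fin r × V)
    (Sum.elim (fun v => (Fin.last r, v)) fun p => (p.1.castSucc, p.2))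
  convert this using 1 <;>
  · funext p
    rcases p with v | p <;> rfl

end Splice

section TensorPower

variable {L : FirstOrder.Language.{u, u}} {U U' : Type u} [L.Structure U] [L.Structure U']
  {T : L.Theory} {κ κ' : Cardinal.{u}} {j : U →[L] U'} {C : Set U'} {V : Type u}

/-- An automorphism of the big monster over `U` that moves a realisation of a global type to
another one. -/
theorem IsMonster.exists_equiv_over_range (hU' : IsMonster T U' κ') (hUU' : #U < κ')
    (hV : #V < κ') {a b : V → U'}
    (h : PosEq L (Sum.elim a (Subtype.val : Set.range j → U'))
      (Sum.elim b (Subtype.val : Set.range j → U'))) :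
    ∃ f : U' ≃[L] U', (∀ v, f (a v) = b v) ∧ ∀ x ∈ Set.range j, f x = x := by
  obtain ⟨f, hf⟩ := hU'.exists_equiv (V := V ⊕ Set.range j) (by
    rw [Cardinal.mk_sum, Cardinal.lift_id, Cardinal.lift_id]
    exact hU'.add_lt hV (Cardinal.mk_range_le.trans_lt hUU')) h
  exact ⟨f, fun v => hf (Sum.inl v), fun x hx => hf (Sum.inr ⟨x, hx⟩)⟩

variable {α : ℕ → V → U'} {c : ℕ → V → U}

/-- In a realisation `α` of a tensor power, increasing finite subtuples of the same length have the
same Lascar strong type over `C`, provided that the Lascar strong types of finite subtuples of `α`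
are realised in `U` by subtuples of `c`. -/
theorem IsMonster.tensor_lascarEq (hU' : IsMonster T U' κ') (hUU' : #U < κ')
    (hC : C ⊆ Set.range j) (hV : #V < κ')
    (hα : ∀ i, IsLsInvariant L C (Set.range j ∪ {x | ∃ k < i, ∃ y, α k y = x}) (α i))
    (htp : ∀ i i', PosEq L (Sum.elim (α i) (Subtype.val : Set.range j → U'))
      (Sum.elim (α i') (Subtype.val : Set.range j → U')))
    (hc : ∀ (r : ℕ) (l : Fin r → ℕ), LascarEq L C (fun p : Fin r × V => j (c (l p.1) p.2))
      (fun p : Fin r × V => α (l p.1) p.2))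
    (r : ℕ) (l l' : Fin r → ℕ) (hl : StrictMono l) (hl' : StrictMono l') :
    LascarEq L C (fun p : Fin r × V => α (l p.1) p.2) (fun p : Fin r × V => α (l' p.1) p.2) := by
  induction r with
  | zero =>
    rw [Subsingleton.elim l l']
    exact .refl _
  | succ r ih =>
    -- The last index may be moved to any larger one: `(α_K, α_l) ≡ (α_K, c_l) ≡ (c_K, c_l)`, and
    -- `α_K`, `α_K'` have the same type over the `c`'s, so that `(α_K, c_l) ≡ (α_K', c_l)`.
    have inv : ∀ (K : ℕ) (x y : Fin r × V → U'),
        (∀ p, x p ∈ Set.range j ∪ {x | ∃ k < K, ∃ y, α k y = x}) →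
        (∀ p, y p ∈ Set.range j ∪ {x | ∃ k < K, ∃ y, α k y = x}) → LascarEq L C x y →
        LascarEq L C (Sum.elim (α K) x) (Sum.elim (α K) y) :=
      fun K x y hx hy h => hα K _ x y hx hy h
    have step : ∀ (i : Fin r → ℕ) (K : ℕ), (∀ x, i x < K) →
        LascarEq L C (Sum.elim (α K) fun p : Fin r × V => α (i p.1) p.2)
          (Sum.elim (α K) fun p : Fin r × V => j (c (i p.1) p.2)) := fun i K hK =>
      inv K _ _ (fun p => Or.inr ⟨_, hK p.1, _, rfl⟩) (fun p => Or.inl ⟨_, rfl⟩) (hc r i).symm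
    have base : ∀ (i : Fin r → ℕ) (K : ℕ), (∀ x, i x < K) →
        LascarEq L C (Sum.elim (α K) fun p : Fin r × V => j (c (i p.1) p.2))
          (Sum.elim (fun v => j (c K v)) fun p : Fin r × V => j (c (i p.1) p.2)) := by
      intro i K hK
      refine (step i K hK).symm.trans ?_
      have := (hc (r + 1) (Fin.snoc i K)).symm
      have := this.unsnoc (x := fun k => α ((Fin.snoc i K : Fin (r + 1) → ℕ) k))
        (y := fun k v => j (c ((Fin.snoc i K : Fin (r + 1) → ℕ) k) v))
      simpa using this
    have move : ∀ (i : Fin r → ℕ) (K K' : ℕ), (∀ x, i x < K) → (∀ x, i x < K') →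
        LascarEq L C (Sum.elim (α K) fun p : Fin r × V => α (i p.1) p.2)
          (Sum.elim (α K') fun p : Fin r × V => α (i p.1) p.2) := by
      intro i K K' hK hK'
      obtain ⟨f, hf, hfr⟩ := hU'.exists_equiv_over_range hUU' hV (htp K K')
      refine (step i K hK).trans (LascarEq.trans ?_ (step i K' hK').symm)
      refine (base i K hK).trans ?_
      have := (base i K hK).map (f := f) fun x hx => hfr x (hC hx)
      convert this.symm using 1
      · funext x
        rcases x with x | x <;> exact (hfr _ ⟨_, rfl⟩).symm
      · funext x
        rcases x with x | x
        · exact (hf x).symm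
        · exact (hfr _ ⟨_, rfl⟩).symm
    have hlast : ∀ i : Fin (r + 1) → ℕ, StrictMono i → ∀ x : Fin r,
        i x.castSucc < i (Fin.last r) := fun i hi x => hi (Fin.castSucc_lt_last x)
    let K := max (l (Fin.last r)) (l' (Fin.last r))
    have hK : ∀ x : Fin r, l x.castSucc < K := fun x => (hlast l hl x).trans_le (le_max_left _ _)
    have hK' : ∀ x : Fin r, l' x.castSucc < K := fun x =>
      (hlast l' hl' x).trans_le (le_max_right _ _)
    refine LascarEq.snoc (x := fun k => α (l k)) (y := fun k => α (l' k)) ?_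
    refine (move (fun x => l x.castSucc) _ K (hlast l hl) hK).trans (LascarEq.trans ?_
      (move (fun x => l' x.castSucc) K _ hK' (hlast l' hl')))
    refine inv K _ _ (fun p => Or.inr ⟨_, hK p.1, _, rfl⟩) (fun p => Or.inr ⟨_, hK' p.1, _, rfl⟩) ?_
    exact ih _ _ (hl.comp (Fin.strictMono_castSucc)) (hl'.comp (Fin.strictMono_castSucc))

theorem IsMonster.tensor_isIndiscernible (hU' : IsMonster T U' κ') (hUU' : #U < κ')
    (hC : C ⊆ Set.range j) (hV : #V < κ')
    (hα : ∀ i, IsLsInvariant L C (Set.range j ∪ {x | ∃ k < i, ∃ y, α k y = x}) (α i))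
    (htp : ∀ i i', PosEq L (Sum.elim (α i) (Subtype.val : Set.range j → U'))
      (Sum.elim (α i') (Subtype.val : Set.range j → U')))
    (hc : ∀ (r : ℕ) (l : Fin r → ℕ), LascarEq L C (fun p : Fin r × V => j (c (l p.1) p.2))
      (fun p : Fin r × V => α (l p.1) p.2)) :
    IsIndiscernible L C α := fun n i i' hi hi' =>
  eqType_iff_posEq.2 (hU'.tensor_lascarEq hUU' hC hV hα htp hc n i i' hi hi').posEq

/-- An initial segment of `α` may be replaced by that of a Morley sequence `c` in `U`. -/
theorem IsMonster.splice_isIndiscernible (hU' : IsMonster T U' κ') (hUU' : #U < κ')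
    (hC : C ⊆ Set.range j) (hV : #V < κ')
    (hα : ∀ i, IsLsInvariant L C (Set.range j ∪ {x | ∃ k < i, ∃ y, α k y = x}) (α i))
    (htp : ∀ i i', PosEq L (Sum.elim (α i) (Subtype.val : Set.range j → U'))
      (Sum.elim (α i') (Subtype.val : Set.range j → U')))
    (hc : ∀ (r : ℕ) (l : Fin r → ℕ), LascarEq L C (fun p : Fin r × V => j (c (l p.1) p.2))
      (fun p : Fin r × V => α (l p.1) p.2)) (N : ℕ) :
    IsIndiscernible L C (splice N (fun k v => j (c k v)) fun k => α (N + k)) := by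
  refine (hU'.tensor_isIndiscernible hUU' hC hV hα htp hc).of_lascarEq fun r => ?_
  have hge : ∀ k, ¬ k < N → splice N (fun k v => j (c k v)) (fun k => α (N + k)) k = α k := by
    intro k hk
    simp only [splice, hk, if_false]
    congr 1
    omega
  have hlt : ∀ k, k < N →
      splice N (fun k v => j (c k v)) (fun k => α (N + k)) k = fun v => j (c k v) := by
    intro k hk
    simp only [splice, hk, if_true]
  induction r with
  | zero =>
    convert LascarEq.refl _ using 1
    funext p
    exact p.1.elim0
  | succ r ih =>
    by_cases hr : r < N
    · convert (hc (r + 1) fun k => k).symm using 1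
      funext p
      rw [hlt _ (by omega)]
    · refine LascarEq.snoc (x := fun k => α k) (y := fun k => splice N _ _ (k : ℕ)) ?_
      simp only [Fin.val_last, Fin.val_castSucc]
      rw [hge r hr]
      refine hα r _ _ _ (fun p => Or.inr ⟨_, p.1.2, _, rfl⟩) (fun p => ?_) ih
      by_cases hp : (p.1 : ℕ) < N
      · rw [hlt _ hp]
        exact Or.inl ⟨_, rfl⟩
      · rw [hge _ hp]
        exact Or.inr ⟨_, p.1.2, _, rfl⟩

end TensorPower

section Extension

variable {L : FirstOrder.Language.{u, u}} {U U' : Type u} [L.Structure U] [L.Structure U']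
  {T : L.Theory} {κ κ' : Cardinal.{u}} {j : U →[L] U'} {C N : Set U'} {V : Type u}

/-- If `y` keeps the `C`-indiscernible sequences of `U`, then some realisation of the type of `y`
over `U` keeps those of a larger set `N`: a finite part of the conditions to be met concerns countably
many parameters, which are moved into `U` by an automorphism. -/
theorem KeepsIndisc.exists_extension [Nonempty U] (hU : IsMonster T U κ) (hU' : IsMonster T U' κ')
    (hUU' : #U < κ') (hT : IsThick L U') (hC : C ⊆ Set.range j) (hCκ : #C < κ) (hV : #V < κ')
    {y : V → U'} (hy : KeepsIndisc L C (Set.range j) y) (hN : Set.range j ⊆ N) (hNκ : #N < κ') :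
    ∃ α : V → U', PosEq L (Sum.elim y (Subtype.val : Set.range j → U'))
      (Sum.elim α (Subtype.val : Set.range j → U')) ∧ KeepsIndisc L C N α := by
  classical
  have : Nonempty U' := ⟨j (Classical.arbitrary U)⟩
  let A := {φ : L.Formula (V ⊕ Set.range j) // IsPositive φ ∧
    φ.Realize (Sum.elim y (Subtype.val : Set.range j → U'))}
  let B := Σ m : ℕ, {s : ℕ → Fin m → U' // (∀ i k, s i k ∈ N) ∧ IsIndiscernible L C s} ×
    (Σ k : ℕ, Fin k → (V ⊕ Fin m) ⊕ C)
  let P : A ⊕ B → (V → U') → Prop := Sum.elim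
    (fun φ α => φ.1.Realize (Sum.elim α (Subtype.val : Set.range j → U')))
    (fun b α => Indisc L fun i k =>
      Sum.elim (Sum.elim α (b.2.1.1 i)) (fun c : C => (c : U')) (b.2.2.2 k))
  have hP : ∀ i, TypeDef L N (P i) := by
    rintro (φ | b)
    · have := typeDef_realize (C := N) (φ := φ.1.relabel (Sum.map id (Set.inclusion hN)))
        (φ.2.1.formula_relabel _)
      convert this using 2 with α
      rw [FirstOrder.Language.Formula.realize_relabel, Sum.elim_comp_map]
      rfl
    · exact hT.typeDef_append (hC.trans hN) id b.2.1.2.1 b.2.2.2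
  obtain ⟨α, hα⟩ := hU'.exists_of_finite hV hNκ hP (by
    intro s
    let S : Set U' := ⋃ b ∈ s, Sum.elim (fun _ : A => ∅)
      (fun b : B => Set.range fun p : ℕ × Fin b.1 => b.2.1.1 p.1 p.2) b
    let D : Set U' := ⋃ b ∈ s, Sum.elim
      (fun φ : A => {x | ∃ z : Set.range j, Sum.inr z ∈ φ.1.freeVarFinset ∧ z.1 = x})
      (fun _ : B => ∅) b
    have hS : S.Countable := by
      refine s.countable_toSet.biUnion fun b _ => ?_
      rcases b with φ | b
      · exact Set.countable_empty
      · exact Set.countable_range _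
    have hD : D.Countable := by
      refine s.countable_toSet.biUnion fun b _ => ?_
      rcases b with φ | b
      · refine Set.Finite.countable ?_
        refine ((φ.1.freeVarFinset.preimage Sum.inr
          Sum.inr_injective.injOn).finite_toSet.image Subtype.val).subset ?_
        rintro x ⟨z, hz, rfl⟩
        exact ⟨z, by simpa using hz, rfl⟩
      · exact Set.countable_empty
    have hDr : D ⊆ Set.range j := by
      refine Set.iUnion₂_subset fun b _ => ?_
      rcases b with φ | b
      · rintro x ⟨z, _, rfl⟩
        exact z.2
      · exact Set.empty_subset _
    have hSκ : #S ≤ ℵ₀ := Cardinal.le_aleph0_iff_set_countable.2 hS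
    have hDκ : #D ≤ ℵ₀ := Cardinal.le_aleph0_iff_set_countable.2 hD
    have hCD : C ∪ D ⊆ Set.range j := Set.union_subset hC hDr
    choose p hp using fun x : ↥(C ∪ D) => hCD x.2
    obtain ⟨a₀, ha₀⟩ := hU.exists_posEq_map hU' j (V := S) (P := ↥(C ∪ D))
      (hSκ.trans_lt hU.aleph0_lt) ((Cardinal.mk_union_le _ _).trans_lt
        (hU.add_lt hCκ (hDκ.trans_lt hU.aleph0_lt))) Subtype.val p
    obtain ⟨f, hf⟩ := hU'.exists_equiv (V := S ⊕ ↥(C ∪ D)) (by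
      rw [Cardinal.mk_sum, Cardinal.lift_id, Cardinal.lift_id]
      exact hU'.add_lt (hSκ.trans_lt hU'.aleph0_lt)
        ((Cardinal.mk_le_mk_of_subset hCD).trans_lt (Cardinal.mk_range_le.trans_lt hUU')))
      ha₀.symm
    have hfS : ∀ x : S, f (j (a₀ x)) = x := fun x => hf (Sum.inl x)
    have hfix : ∀ x ∈ C ∪ D, f x = x := by
      intro x hx
      have := hf (Sum.inr ⟨x, hx⟩)
      simp only [Sum.elim_inr] at this
      rwa [hp] at this
    have hfC : ∀ x ∈ C, f x = x := fun x hx => hfix x (Or.inl hx)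
    have hfC' : ∀ x ∈ C, f.symm x = x := fun x hx => by
      conv_lhs => rw [← hfC x hx]
      exact f.symm_apply_apply x
    refine ⟨fun v => f (y v), ?_⟩
    rintro (φ | b) hb
    · have h1 := (posEq_equiv f (Sum.elim y (Subtype.val : Set.range j → U')) φ.1 φ.2.1).2 φ.2.2
      refine (realize_congr_freeVarFinset φ.1 ?_).1 h1
      rintro (v | z) hz
      · rfl
      · exact hfix _ (Or.inr (Set.mem_iUnion₂.2 ⟨_, hb, z, hz, rfl⟩))
    · obtain ⟨m, ⟨t, htN, ht⟩, k, g⟩ := b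
      have htS : ∀ i x, t i x ∈ S := fun i x =>
        Set.mem_iUnion₂.2 ⟨_, hb, ⟨(i, x), rfl⟩⟩
      have h1 : ∀ i x, f.symm (t i x) = j (a₀ ⟨t i x, htS i x⟩) := fun i x => by
        have h2 := congrArg f.symm (hfS ⟨t i x, htS i x⟩)
        rw [f.symm_apply_apply] at h2
        exact h2.symm
      have h2 := (hy m (fun i x => f.symm (t i x)) (fun i x => by rw [h1]; exact ⟨_, rfl⟩)
        (ht.map hfC')).map hfC
      have h3 := h2.finite g
      change Indisc L fun i x => Sum.elim (Sum.elim (fun v => f (y v)) (t i))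
        (fun c : C => (c : U')) (g x)
      convert h3 using 3 with i x
      rcases hg : g x with (v | x) | c
      · rfl
      · exact (f.apply_symm_apply _).symm
      · rfl)
  refine ⟨α, ?_, fun m s hsN hs => isIndiscernible_of_finite fun k g =>
    hα (Sum.inr ⟨m, ⟨s, hsN, hs⟩, k, g⟩)⟩
  exact hU'.ec.posEq_of_imp hU'.ec.1 fun φ hφ h => hα (Sum.inl ⟨φ, hφ, h⟩)

end Extension

/-! ### Locally Morley sequences -/

section LocallyMorley

variable {L : FirstOrder.Language.{u, u}} {U U' : Type u} [L.Structure U] [L.Structure U']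
  {T : L.Theory} {κ κ' : Cardinal.{u}} {j : U →[L] U'} {C : Set U'}

/-- Every finite part of the sequence `b` continues to a `C`-indiscernible sequence in the bigger
monster by a sequence `y` whose first term keeps the `C`-indiscernible sequences of `U`. The same `y`
has to continue all the initial segments of the part, as it does when `y` is a final segment of a
realisation of a tensor power; this allows for compactness. -/
def LocallyMorley (j : U →[L] U') (C : Set U') {V : Type w} (b : ℕ → V → U) : Prop :=
  ∀ (N k : ℕ) (g : Fin k → V), ∃ y : ℕ → Fin k → U', KeepsIndisc L C (Set.range j) (y 0) ∧
    ∀ n ≤ N, IsIndiscernible L C (splice n (fun i x => j (b i (g x))) y)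

theorem LocallyMorley.comp {V : Type v} {W : Type w} {b : ℕ → V → U} (h : LocallyMorley j C b)
    (f : W → V) : LocallyMorley j C fun i x => b i (f x) :=
  fun N k g => h N k (f ∘ g)

theorem LocallyMorley.eq_iff {V : Type w} {b : ℕ → V → U} (h : LocallyMorley j C b) (i : ℕ)
    (v v' : V) : j (b 0 v) = j (b 0 v') ↔ j (b i v) = j (b i v') := by
  obtain ⟨y, _, hy⟩ := h (i + 1) 2 ![v, v']
  have h1 := ((hy (i + 1) le_rfl).posEq 0 i).eq_iff (Sum.inl 0) (Sum.inl 1)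
  simpa [splice] using h1

/-- By compactness, a single continuation serves all finite parts. -/
theorem LocallyMorley.exists_continuation [Nonempty U'] {V : Type u} {b : ℕ → V → U}
    (h : LocallyMorley j C b) (hU' : IsMonster T U' κ') (hUU' : #U < κ') (hT : IsThick L U')
    (hC : C ⊆ Set.range j) (hV : #V < κ') :
    ∃ y : ℕ → V → U', KeepsIndisc L C (Set.range j) (y 0) ∧
      ∀ n, IsIndiscernible L C (splice n (fun i v => j (b i v)) y) := by
  classical
  let A := Σ (_ : ℕ) (m : ℕ), Fin m → V ⊕ C
  let B := Σ m : ℕ, {s : ℕ → Fin m → U' // (∀ i k, s i k ∈ Set.range j) ∧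
    IsIndiscernible L C s} × (Σ k : ℕ, Fin k → (V ⊕ Fin m) ⊕ C)
  let P : A ⊕ B → (ℕ × V → U') → Prop := Sum.elim
    (fun a y => Indisc L fun i k => Sum.elim
      (splice a.1 (fun i v => j (b i v)) (fun t v => y (t, v)) i) (fun c : C => (c : U')) (a.2.2 k))
    (fun b y => Indisc L fun i k =>
      Sum.elim (Sum.elim (fun v => y (0, v)) (b.2.1.1 i)) (fun c : C => (c : U')) (b.2.2.2 k))
  have hP : ∀ i, TypeDef L (Set.range j) (P i) := by
    rintro (a | b)
    · exact hT.typeDef_splice hC a.1 (fun i v => ⟨_, rfl⟩) a.2.2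
    · exact hT.typeDef_append hC (fun v => ((0 : ℕ), v)) b.2.1.2.1 b.2.2.2
  have hNV : #(ℕ × V) < κ' := by
    rw [Cardinal.mk_prod, Cardinal.lift_id', Cardinal.mk_nat, Cardinal.lift_aleph0]
    exact hU'.mul_lt hU'.aleph0_lt hV
  obtain ⟨y, hy⟩ := hU'.exists_of_finite hNV (Cardinal.mk_range_le.trans_lt hUU') hP (by
    intro s
    -- the finitely many variables that occur in `s`
    let vars : A ⊕ B → Finset V := Sum.elim
      (fun a => Finset.univ.biUnion fun x => Sum.elim (fun v => {v}) (fun _ => ∅) (a.2.2 x))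
      (fun b => Finset.univ.biUnion fun x =>
        Sum.elim (Sum.elim (fun v => {v}) fun _ => ∅) (fun _ => ∅) (b.2.2.2 x))
    let V₀ : Finset V := s.biUnion vars
    let N : ℕ := s.sup (Sum.elim (fun a => a.1) fun _ => 0)
    let e := V₀.equivFin
    obtain ⟨y, hy0, hy⟩ := h N V₀.card fun x => e.symm x
    let d : U' := Classical.arbitrary U'
    let Y : ℕ → V → U' := fun t v => if hv : v ∈ V₀ then y t (e ⟨v, hv⟩) else d
    have hY : ∀ t v (hv : v ∈ V₀), Y t v = y t (e ⟨v, hv⟩) := fun t v hv => dif_pos hv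
    refine ⟨fun p => Y p.1 p.2, ?_⟩
    rintro (a | b') ha
    · have hn : a.1 ≤ N := Finset.le_sup (f := Sum.elim (fun a : A => a.1) fun _ : B => 0) ha
      have hmem : ∀ x v, a.2.2 x = Sum.inl v → v ∈ V₀ := fun x v hx =>
        Finset.mem_biUnion.2 ⟨_, ha, Finset.mem_biUnion.2 ⟨x, Finset.mem_univ _, by simp [hx]⟩⟩
      have hg : ∀ x, ∃ z : Fin V₀.card ⊕ C, ∀ i,
          Sum.elim (splice a.1 (fun i v => j (b i v)) Y i) (fun c : C => (c : U')) (a.2.2 x) =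
          Sum.elim (splice a.1 (fun i x => j (b i (e.symm x))) y i)
            (fun c : C => (c : U')) z := by
        intro x
        rcases hx : a.2.2 x with v | c
        · refine ⟨Sum.inl (e ⟨v, hmem x v hx⟩), fun i => ?_⟩
          by_cases hi : i < a.1
          · simp [splice, hi]
          · simp [splice, hi, hY _ v (hmem x v hx)]
        · exact ⟨Sum.inr c, fun i => rfl⟩
      choose g' hg' using hg
      have := (hy a.1 hn).finite g'
      change Indisc L fun i x => Sum.elim (splice a.1 (fun i v => j (b i v)) Y i)
        (fun c : C => (c : U')) (a.2.2 x)
      convert this using 3 with i x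
      exact hg' x i
    · have hmem : ∀ x v, b'.2.2.2 x = Sum.inl (Sum.inl v) → v ∈ V₀ := fun x v hx =>
        Finset.mem_biUnion.2 ⟨_, ha, Finset.mem_biUnion.2 ⟨x, Finset.mem_univ _, by simp [hx]⟩⟩
      have hg : ∀ x, ∃ z : (Fin V₀.card ⊕ Fin b'.1) ⊕ C, ∀ i,
          Sum.elim (Sum.elim (Y 0) (b'.2.1.1 i)) (fun c : C => (c : U')) (b'.2.2.2 x) =
          Sum.elim (Sum.elim (y 0) (b'.2.1.1 i)) (fun c : C => (c : U')) z := by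
        intro x
        rcases hx : b'.2.2.2 x with (v | z) | c
        · exact ⟨Sum.inl (Sum.inl (e ⟨v, hmem x v hx⟩)), fun i => hY _ v (hmem x v hx)⟩
        · exact ⟨Sum.inl (Sum.inr z), fun i => rfl⟩
        · exact ⟨Sum.inr c, fun i => rfl⟩
      choose g' hg' using hg
      have := (hy0 _ b'.2.1.1 b'.2.1.2.1 b'.2.1.2.2).finite g'
      change Indisc L fun i x => Sum.elim (Sum.elim (Y 0) (b'.2.1.1 i))
        (fun c : C => (c : U')) (b'.2.2.2 x)
      convert this using 3 with i x
      exact hg' x i)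
  refine ⟨fun t v => y (t, v), fun m s hs hsi => isIndiscernible_of_finite fun k g =>
    hy (Sum.inr ⟨m, ⟨s, hs, hsi⟩, k, g⟩), fun n => isIndiscernible_of_finite fun m g =>
    hy (Sum.inl ⟨n, m, g⟩)⟩

/-- A global type that keeps `C`-indiscernible sequences has a tensor power. -/
theorem KeepsIndisc.exists_tensorPower [Nonempty U] {V : Type u} (hU : IsMonster T U κ)
    (hU' : IsMonster T U' κ') (hUU' : #U < κ') (hT : IsThick L U') (hC : C ⊆ Set.range j)
    (hCκ : #C < κ) (hV : #V < κ') {y : V → U'} (hy : KeepsIndisc L C (Set.range j) y) :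
    ∃ α : ℕ → V → U', ∀ i, PosEq L (Sum.elim y (Subtype.val : Set.range j → U'))
      (Sum.elim (α i) (Subtype.val : Set.range j → U')) ∧
      IsLsInvariant L C (Set.range j ∪ {x | ∃ k < i, ∃ v, α k v = x}) (α i) := by
  have key : ∀ N : Set U', ∃ α : V → U', Set.range j ⊆ N → #N < κ' →
      PosEq L (Sum.elim y (Subtype.val : Set.range j → U'))
        (Sum.elim α (Subtype.val : Set.range j → U')) ∧ IsLsInvariant L C N α := by
    intro N
    by_cases hN : Set.range j ⊆ N ∧ #N < κ'
    · obtain ⟨K, hNK, hK, hKl⟩ := hU'.exists_linkIn C hN.2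
      obtain ⟨α, h1, h2⟩ := hy.exists_extension hU hU' hUU' hT hC hCκ hV (hN.1.trans hNK) hK
      exact ⟨α, fun _ _ => ⟨h1, h2.isLsInvariant hKl⟩⟩
    · exact ⟨y, fun h1 h2 => absurd ⟨h1, h2⟩ hN⟩
  choose F hF using key
  let B : ℕ → Set U' := fun i => Nat.rec (Set.range j) (fun _ N => N ∪ Set.range (F N)) i
  have hB : ∀ i, B (i + 1) = B i ∪ Set.range (F (B i)) := fun i => rfl
  have hBr : ∀ i, Set.range j ⊆ B i ∧ #↥(B i) < κ' := by
    intro i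
    induction i with
    | zero => exact ⟨le_rfl, Cardinal.mk_range_le.trans_lt hUU'⟩
    | succ i ih =>
      rw [hB]
      exact ⟨ih.1.trans Set.subset_union_left, (Cardinal.mk_union_le _ _).trans_lt
        (hU'.add_lt ih.2 (Cardinal.mk_range_le.trans_lt hV))⟩
  have hBeq : ∀ i, B i = Set.range j ∪ {x | ∃ k < i, ∃ v, F (B k) v = x} := by
    intro i
    induction i with
    | zero =>
      have : {x : U' | ∃ k < 0, ∃ v, F (B k) v = x} = ∅ := by
        ext x
        simp
      rw [this, Set.union_empty]
      rfl
    | succ i ih =>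
      rw [hB]
      conv_lhs => rw [ih]
      rw [Set.union_assoc, ← ih]
      congr 1
      ext x
      constructor
      · rintro (⟨k, hk, hx⟩ | ⟨v, hx⟩)
        · exact ⟨k, hk.trans (Nat.lt_succ_self i), hx⟩
        · exact ⟨i, Nat.lt_succ_self i, v, hx⟩
      · rintro ⟨k, hk, hx⟩
        rcases Nat.lt_succ_iff_lt_or_eq.1 hk with hk | rfl
        · exact Or.inl ⟨k, hk, hx⟩
        · exact Or.inr hx
  refine ⟨fun i => F (B i), fun i => ?_⟩
  rw [← hBeq]
  exact hF _ (hBr i).1 (hBr i).2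

/-- If every initial segment of `α` has the Lascar strong type of that of `b`, then the whole
sequences have the same Lascar strong type. Finite segments are at a bounded distance: both of the
sequences `b_{<N}, α_{[N,2N)}, α_{[2N,3N)}, …` and `α_{<N}, α_{[N,2N)}, α_{[2N,3N)}, …` are
`C`-indiscernible. -/
theorem IsMonster.lascarEq_tensorPower {V : Type u} (hU' : IsMonster T U' κ')
    (hUU' : #U < κ') (hT : IsThick L U') (hC : C ⊆ Set.range j) (hV : #V < κ')
    {α : ℕ → V → U'} {b : ℕ → V → U}
    (hα : ∀ i, IsLsInvariant L C (Set.range j ∪ {x | ∃ k < i, ∃ y, α k y = x}) (α i))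
    (htp : ∀ i i', PosEq L (Sum.elim (α i) (Subtype.val : Set.range j → U'))
      (Sum.elim (α i') (Subtype.val : Set.range j → U')))
    (hb : ∀ r : ℕ, LascarEq L C (fun p : Fin r × V => j (b p.1 p.2))
      (fun p : Fin r × V => α p.1 p.2)) :
    LascarEq L C (fun p : ℕ × V => j (b p.1 p.2)) (fun p : ℕ × V => α p.1 p.2) := by
  classical
  have hb' : ∀ (r : ℕ) (l : Fin r → ℕ), LascarEq L C (fun p : Fin r × V => j (b (l p.1) p.2))
      (fun p : Fin r × V => α (l p.1) p.2) := by
    intro r l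
    have hlt : ∀ k, l k < Finset.univ.sup l + 1 := fun k =>
      Nat.lt_succ_of_le (Finset.le_sup (Finset.mem_univ k))
    exact (hb (Finset.univ.sup l + 1)).comp fun p : Fin r × V => (⟨l p.1, hlt p.1⟩, p.2)
  let N : Set U' := Set.range j ∪ Set.range fun p : ℕ × V => α p.1 p.2
  have hNV : #(ℕ × V) < κ' := by
    rw [Cardinal.mk_prod, Cardinal.lift_id', Cardinal.mk_nat, Cardinal.lift_aleph0]
    exact hU'.mul_lt hU'.aleph0_lt hV
  have hNκ : #N < κ' := (Cardinal.mk_union_le _ _).trans_lt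
    (hU'.add_lt (Cardinal.mk_range_le.trans_lt hUU') (Cardinal.mk_range_le.trans_lt hNV))
  have hCN : C ⊆ N := hC.trans Set.subset_union_left
  let base : Bool → ℕ × V → U' := fun β p => if β then j (b p.1 p.2) else α p.1 p.2
  have hbase : ∀ β p, base β p ∈ N := by
    rintro (_ | _) p
    · exact Or.inr ⟨p, rfl⟩
    · exact Or.inl ⟨_, rfl⟩
  let P : (Bool × Σ m : ℕ, Fin m → (ℕ × V) ⊕ C) → (ℕ × (ℕ × V) → U') → Prop := fun a y =>
    Indisc L fun i k => Sum.elim (splice 1 (fun _ => base a.1) (fun t v => y (t, v)) i)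
      (fun c : C => (c : U')) (a.2.2 k)
  have hNNV : #(ℕ × (ℕ × V)) < κ' := by
    rw [Cardinal.mk_prod, Cardinal.lift_id', Cardinal.mk_nat, Cardinal.lift_aleph0]
    exact hU'.mul_lt hU'.aleph0_lt hNV
  obtain ⟨y, hy⟩ := hU'.exists_of_finite (P := P) hNNV hNκ
    (fun a => hT.typeDef_splice hCN 1 (fun _ v => hbase a.1 v) a.2.2) (by
    intro s
    let idx : (ℕ × V) ⊕ C → ℕ := Sum.elim (fun p => p.1 + 1) fun _ => 0
    let M : ℕ := s.sup fun a => Finset.univ.sup fun x => idx (a.2.2 x)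
    refine ⟨fun p => α ((p.1 + 1) * M + p.2.1) p.2.2, ?_⟩
    rintro ⟨β, m, g⟩ ha
    have hM : ∀ x p, g x = Sum.inl p → p.1 < M := by
      intro x p hx
      have h1 : idx (g x) ≤ Finset.univ.sup fun x => idx (g x) :=
        Finset.le_sup (f := fun x => idx (g x)) (Finset.mem_univ x)
      have h2 : (Finset.univ.sup fun x => idx (g x)) ≤ M :=
        Finset.le_sup (f := fun a : Bool × Σ m : ℕ, Fin m → (ℕ × V) ⊕ C =>
          Finset.univ.sup fun x => idx (a.2.2 x)) ha
      have h3 : idx (g x) = p.1 + 1 := by rw [hx]; rfl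
      omega
    obtain ⟨d, hd, hdlt, hdge⟩ : ∃ d : ℕ → V → U', IsIndiscernible L C d ∧
        (∀ k v, k < M → d k v = base β (k, v)) ∧ ∀ k, M ≤ k → d k = α k := by
      cases β with
      | false =>
        exact ⟨α, hU'.tensor_isIndiscernible hUU' hC hV hα htp hb', fun _ _ _ => rfl,
          fun _ _ => rfl⟩
      | true =>
        refine ⟨_, hU'.splice_isIndiscernible hUU' hC hV hα htp hb' M, fun k v hk => ?_,
          fun k hk => ?_⟩
        · simp [splice, hk, base]
        · simp [splice, Nat.not_lt.2 hk, Nat.add_sub_cancel' hk]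
    have hblocks := hd.blocks (J := Fin M) (e := fun k x => k * M + x)
      (fun k x y hxy => Nat.add_lt_add_left hxy _) (by
        intro k l x y hkl
        have h1 : (k + 1) * M ≤ l * M := Nat.mul_le_mul_right M hkl
        have h2 := x.2
        rw [Nat.succ_mul] at h1
        change k * M + x < l * M + y
        omega)
    have hg : ∀ x, ∃ z : (Fin M × V) ⊕ C, ∀ i,
        Sum.elim (splice 1 (fun _ => base β) (fun t (p : ℕ × V) => α ((t + 1) * M + p.1) p.2) i)
          (fun c : C => (c : U')) (g x) =
        Sum.elim (fun p : Fin M × V => d (i * M + p.1) p.2) (fun c : C => (c : U')) z := by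
      intro x
      rcases hx : g x with p | c
      · refine ⟨Sum.inl (⟨p.1, hM x p hx⟩, p.2), fun i => ?_⟩
        rcases i with _ | i
        · simp [splice, hdlt _ _ (hM x p hx)]
        · have h1 : M ≤ (i + 1) * M + p.1 := by
            rw [Nat.succ_mul]
            omega
          simp [splice, hdge _ h1]
      · exact ⟨Sum.inr c, fun i => rfl⟩
    choose g' hg' using hg
    have := hblocks.finite g'
    change Indisc L fun i x => Sum.elim (splice 1 (fun _ => base β)
      (fun t (p : ℕ × V) => α ((t + 1) * M + p.1) p.2) i) (fun c : C => (c : U')) (g x)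
    convert this using 3 with i x
    exact hg' x i)
  have hind : ∀ β, LascarEq L C (base β) fun p => y (0, p) := by
    intro β
    have h1 : IsIndiscernible L C (splice 1 (fun _ => base β) fun t p => y (t, p)) :=
      isIndiscernible_of_finite fun m g => hy (β, ⟨m, g⟩)
    exact h1.lascarEq 0 1
  exact (hind true).trans (hind false).symm

/-- A locally Morley sequence has the Lascar strong type of a realisation of a tensor power. -/
theorem LocallyMorley.exists_tensorPower [Nonempty U] {V : Type u} {b : ℕ → V → U}
    (h : LocallyMorley j C b) (hU : IsMonster T U κ) (hU' : IsMonster T U' κ') (hUU' : #U < κ')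
    (hT : IsThick L U') (hC : C ⊆ Set.range j) (hCκ : #C < κ) (hV : #V < κ') :
    ∃ α : ℕ → V → U', (∀ i, EqType L (Set.range j) (α i) (α 0) ∧
      IsLsInvariant L C (Set.range j ∪ {x | ∃ k < i, ∃ v, α k v = x}) (α i)) ∧
      LascarEq L C (fun p : ℕ × V => j (b p.1 p.2)) (fun p : ℕ × V => α p.1 p.2) := by
  have : Nonempty U' := ⟨j (Classical.arbitrary U)⟩
  obtain ⟨y, hy0, hy⟩ := h.exists_continuation hU' hUU' hT hC hV
  obtain ⟨α, hα⟩ := hy0.exists_tensorPower hU hU' hUU' hT hC hCκ hV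
  have htp : ∀ i i', PosEq L (Sum.elim (α i) (Subtype.val : Set.range j → U'))
      (Sum.elim (α i') (Subtype.val : Set.range j → U')) :=
    fun i i' => (hα i).1.symm.trans (hα i').1
  refine ⟨α, fun i => ⟨eqType_iff_posEq.2 (htp i 0), (hα i).2⟩,
    hU'.lascarEq_tensorPower hUU' hT hC hV (fun i => (hα i).2) htp fun r => ?_⟩
  induction r with
  | zero =>
    convert LascarEq.refl _ using 1
    funext p
    exact p.1.elim0
  | succ r ih =>
    -- `(α_r, α_{<r}) ≡ (α_r, b_{<r})` by invariance; and `(α_r, b_{<r}) ≡ (b_r, b_{<r})` as both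
    -- are increasing subtuples of the indiscernible sequence `b_0, …, b_r, α_r, …`.
    refine LascarEq.snoc (x := fun k v => j (b k v)) (y := fun k => α k) ?_
    simp only [Fin.val_last, Fin.val_castSucc]
    have h1 : LascarEq L C (Sum.elim (α r) fun p : Fin r × V => j (b p.1 p.2))
        (Sum.elim (α r) fun p : Fin r × V => α p.1 p.2) :=
      (hα r).2 _ _ _ (fun p => Or.inl ⟨_, rfl⟩) (fun p => Or.inr ⟨_, p.1.2, _, rfl⟩) ih
    refine LascarEq.trans ?_ h1
    obtain ⟨f, hf, hfr⟩ := hU'.exists_equiv_over_range hUU' hV (hα r).1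
    have h2 := ((hy (r + 1)).map fun x hx => hfr x (hC hx)).lascarEq_of_strictMono
      (n := r + 1) (i := fun k => k) (j := Fin.snoc (fun k => k) (r + 1)) (fun _ _ h => h) (by
        intro x x' hx
        refine Fin.lastCases (fun hx => ?_) (fun q hx => ?_) x' hx
        · have hne := Fin.ne_last_of_lt hx
          obtain ⟨q, rfl⟩ := Fin.exists_castSucc_eq.2 hne
          simp only [Fin.snoc_castSucc, Fin.snoc_last]
          omega
        · have hne : x ≠ Fin.last r := ne_of_lt (hx.trans (Fin.castSucc_lt_last q))
          obtain ⟨q', rfl⟩ := Fin.exists_castSucc_eq.2 hne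
          simp only [Fin.snoc_castSucc]
          exact hx)
    have h3 := h2.unsnoc (x := fun k v => f (splice (r + 1) (fun i v => j (b i v)) y k v))
      (y := fun k v => f (splice (r + 1) (fun i v => j (b i v)) y
        ((Fin.snoc (fun k : Fin r => (k : ℕ)) (r + 1) : Fin (r + 1) → ℕ) k) v))
    convert h3 using 1
    · funext x
      rcases x with v | p
      · simp [splice, hfr]
      · simp [splice, hfr]
    · funext x
      rcases x with v | p
      · simp [splice, hf]
      · simp [splice, hfr]

end LocallyMorley

/-! ### Finite parts of Morley sequences -/

section Morley

variable {L : FirstOrder.Language.{u, u}} {U U' : Type u} [L.Structure U] [L.Structure U']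
  {T : L.Theory} {κ κ' : Cardinal.{u}} {j : U →[L] U'} {M : Set U}

theorem IsIndiscernible.comp {V : Type v} {W : Type w} {C : Set U} {s : ℕ → V → U}
    (h : IsIndiscernible L C s) (g : W → V) : IsIndiscernible L C fun i => s i ∘ g := by
  rw [isIndiscernible_iff] at h ⊢
  have := h.comp (Sum.map g id : W ⊕ C → V ⊕ C)
  simpa [Sum.elim_comp_map] using this

theorem KeepsIndisc.comp {V : Type v} {W : Type w} {C N : Set U} {α : V → U}
    (h : KeepsIndisc L C N α) (g : W → V) : KeepsIndisc L C N (α ∘ g) := by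
  intro m s hs hi
  have := (h m s hs hi).comp (Sum.map g id : W ⊕ Fin m → V ⊕ Fin m)
  simpa [Sum.elim_comp_map] using this

/-- A sequence in `U` whose finite parts have the same types over `M` as finite parts of Morley
sequences over `M` is locally Morley: automorphisms over `M` move these Morley sequences, and the
realisations of tensor powers that continue them, to the given finite parts. -/
theorem IsMonster.locallyMorley_of_posEq {V : Type v} {b : ℕ → V → U} (hU : IsMonster T U κ)
    (hU' : IsMonster T U' κ') (hUU' : #U < κ') (hMκ : #M < κ)
    (h : ∀ (N k : ℕ) (g : Fin k → V), ∃ (W : Type w) (q : Set (L.Formula (W ⊕ Set.range j)))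
      (c : ℕ → W → U) (h : Fin k → W), IsMorleySequence j M q c ∧
      PosEq L (Sum.elim (fun p : Fin N × Fin k => c p.1 (h p.2)) (Subtype.val : M → U))
        (Sum.elim (fun p : Fin N × Fin k => b p.1 (g p.2)) (Subtype.val : M → U))) :
    LocallyMorley j (j '' M) b := by
  intro N k g
  obtain ⟨W, q, c, h, ⟨α, hα, hc⟩, heq⟩ := h N k g
  have hC : j '' M ⊆ Set.range j := Set.image_subset_range _ _
  have hfin : #(ULift.{u} (Fin k)) < κ' :=
    (Cardinal.mk_le_aleph0 (α := ULift.{u} (Fin k))).trans_lt hU'.aleph0_lt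
  -- the coordinates in question of the realisation of the tensor power
  let A : ℕ → ULift.{u} (Fin k) → U' := fun i x => α i (h x.down)
  have hA : ∀ i, IsLsInvariant L (j '' M) (Set.range j ∪ {x | ∃ k < i, ∃ y, A k y = x}) (A i) :=
    fun i => ((hα i).2.comp fun x : ULift.{u} (Fin k) => h x.down).mono <|
      Set.union_subset_union_right _ (by
        rintro x ⟨k, hk, y, hy⟩
        exact ⟨k, hk, _, hy⟩)
  have htp : ∀ i i', PosEq L (Sum.elim (A i) (Subtype.val : Set.range j → U'))
      (Sum.elim (A i') (Subtype.val : Set.range j → U')) := by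
    intro i i'
    have h1 : EqType L (Set.range j) (α i) (α i') := (hα i).1.trans (hα i').1.symm
    have := (eqType_iff_posEq.1 h1).comp (Sum.map (fun x : ULift.{u} (Fin k) => h x.down) id)
    simp only [Sum.elim_comp_map] at this
    exact this
  have hcA : ∀ (r : ℕ) (l : Fin r → ℕ), LascarEq L (j '' M)
      (fun p : Fin r × ULift.{u} (Fin k) => j (c (l p.1) (h p.2.down)))
      (fun p : Fin r × ULift.{u} (Fin k) => A (l p.1) p.2) := fun r l =>
    hc.comp fun p : Fin r × ULift.{u} (Fin k) => (l p.1, h p.2.down)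
  have hind := hU'.splice_isIndiscernible (c := fun i x => c i (h x.down)) hUU' hC hfin hA htp hcA N
  have hkeep := (hA N).keepsIndisc
  obtain ⟨f, hf⟩ := hU.exists_equiv (V := ULift.{u} (Fin N × Fin k) ⊕ M) (by
    rw [Cardinal.mk_sum, Cardinal.lift_id, Cardinal.lift_id]
    exact hU.add_lt ((Cardinal.mk_le_aleph0 (α := ULift.{u} (Fin N × Fin k))).trans_lt
      hU.aleph0_lt) hMκ) (heq.comp (Sum.map ULift.down id))
  obtain ⟨f', hf'⟩ := hU.exists_equiv_extend hU' hUU' j f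
  have hfM : ∀ x ∈ j '' M, f' x = x := by
    rintro _ ⟨x, hx, rfl⟩
    rw [hf']
    exact congrArg j (hf (Sum.inr ⟨x, hx⟩))
  have hsymm : ∀ x ∈ Set.range j, f'.symm x ∈ Set.range j := by
    rintro _ ⟨x, rfl⟩
    refine ⟨f.symm x, ?_⟩
    have := hf' (f.symm x)
    rw [f.apply_symm_apply] at this
    rw [← this, f'.symm_apply_apply]
  refine ⟨fun t x => f' (A (N + t) (ULift.up x)), ?_, fun n hn => ?_⟩
  · exact (((hkeep.mono Set.subset_union_left).map hfM hsymm).comp ULift.up)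
  · have h1 := ((hind.map hfM).comp (ULift.up : Fin k → _)).subseq
      (e := fun i => if i < n then i else N + (i - n)) (by
        intro x y hxy
        by_cases h1 : x < n <;> by_cases h2 : y < n <;> simp only [h1, h2, if_true, if_false] <;>
          omega)
    convert h1 using 1
    funext i x
    by_cases hi : i < n
    · have hiN : i < N := by omega
      have h2 := hf (Sum.inl (ULift.up (⟨i, hiN⟩, x)))
      simp only [Function.comp_apply, Sum.map_inl, Sum.elim_inl] at h2
      simp [splice, hi, hiN, hf', h2]
    · simp [splice, hi]

/-- Locally Morley sequences are Morley sequences. -/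
theorem LocallyMorley.exists_isMorleySequence [Nonempty U] {V : Type w} {b : ℕ → V → U}
    (h : LocallyMorley j (j '' M) b) (hU : IsMonster T U κ) (hU' : IsMonster T U' κ')
    (hUU' : #U < κ') (hT : IsThick L U) (hMκ : #M < κ) :
    ∃ q : Set (L.Formula (V ⊕ Set.range j)), IsGlobalLsInvariant j M q ∧
      (∀ φ ∈ tp (L := L) M (b 0),
        φ.relabel (Sum.map id fun c : M =>
          (⟨j c, Set.mem_range_self (c : U)⟩ : Set.range j)) ∈ q) ∧
      IsMorleySequence j M q b := by
  have hinj : Function.Injective j := fun x y hxy =>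
    ((hU.posEq_map hU' j (id : U → U)).eq_iff x y).2 hxy
  -- All the terms of the sequence repeat their entries at the same places, so the index set may be
  -- replaced by the range of `b 0`, which is small in `U'`.
  choose σ hσ using fun x : Set.range (b 0) => x.2
  let π : V → Set.range (b 0) := fun v => ⟨b 0 v, v, rfl⟩
  have hπ : ∀ i v, b i (σ (π v)) = b i v := fun i v =>
    hinj ((h.eq_iff i _ _).1 (congrArg j (hσ (π v))))
  obtain ⟨α, hα, hL⟩ := (h.comp σ).exists_tensorPower hU hU' hUU' (hT.lift hU hU' j)
    (Set.image_subset_range _ _) (Cardinal.mk_image_le.trans_lt hMκ)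
    ((Cardinal.mk_set_le _).trans_lt hUU')
  have hinv : ∀ i, IsLsInvariant L (j '' M)
      (Set.range j ∪ {x | ∃ k < i, ∃ v : V, α k (π v) = x}) (α i ∘ π) := fun i =>
    ((hα i).2.comp π).mono (Set.union_subset_union_right _ (by
      rintro x ⟨k, hk, y, hy⟩
      exact ⟨k, hk, _, hy⟩))
  have hLπ : LascarEq L (j '' M) (fun p : ℕ × V => j (b p.1 p.2))
      (fun p : ℕ × V => α p.1 (π p.2)) := by
    have := hL.comp fun p : ℕ × V => (p.1, π p.2)
    simpa [Function.comp_def, hπ] using this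
  refine ⟨tp (Set.range j) (α 0 ∘ π), ⟨α 0 ∘ π, rfl, (hinv 0).mono Set.subset_union_left⟩,
    ?_, fun i => α i ∘ π, fun i => ⟨?_, hinv i⟩, hLπ⟩
  · rintro φ ⟨hφ, hr⟩
    refine ⟨hφ.formula_relabel _, ?_⟩
    rw [FirstOrder.Language.Formula.realize_relabel]
    have h1 := (hU.posEq_map hU' j _ φ hφ).1 hr
    have h2 := hLπ.posEq.comp (W := V ⊕ M)
      (Sum.map (fun v => ((0 : ℕ), v)) fun c => (⟨j c, c, c.2, rfl⟩ : ↥(j '' M)))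
    have h3 := (h2 φ hφ).1 (by
      convert h1 using 1
      funext x
      rcases x with x | x <;> rfl)
    convert h3 using 1
    funext x
    rcases x with x | x <;> rfl
  · have := (eqType_iff_posEq.1 (hα i).1).comp (Sum.map π id : V ⊕ Set.range j → _)
    refine eqType_iff_posEq.2 ?_
    simpa [Sum.elim_comp_map] using this

/-- If `U` is empty, then so is `U'`, and all tuples coincide. -/
theorem exists_isMorleySequence_of_isEmpty [IsEmpty U] {V : Type w} (hU : IsMonster T U κ)
    (hU' : IsMonster T U' κ') (b : ℕ → V → U) :
    ∃ q : Set (L.Formula (V ⊕ Set.range j)), IsGlobalLsInvariant j M q ∧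
      (∀ φ ∈ tp (L := L) M (b 0),
        φ.relabel (Sum.map id fun c : M =>
          (⟨j c, Set.mem_range_self (c : U)⟩ : Set.range j)) ∈ q) ∧
      IsMorleySequence j M q b := by
  have hU'e : IsEmpty U' := by
    refine ⟨fun x => ?_⟩
    have hex : IsPositive (⊤ : L.BoundedFormula Empty 1).ex := .ex .top
    have h1 := hU.posEq_map hU' j (Empty.elim : Empty → U) _ hex
    have h2 : FirstOrder.Language.Formula.Realize (⊤ : L.BoundedFormula Empty 1).ex
        (fun i => j ((Empty.elim : Empty → U) i)) := by
      rw [FirstOrder.Language.Formula.Realize, FirstOrder.Language.BoundedFormula.realize_ex]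
      exact ⟨x, by simp⟩
    have h3 := h1.2 h2
    rw [FirstOrder.Language.Formula.Realize, FirstOrder.Language.BoundedFormula.realize_ex] at h3
    exact isEmptyElim h3.choose
  have hinv : ∀ (N : Set U') (a : V → U'), IsLsInvariant L (j '' M) N a := by
    intro N a W c c' _ _ _
    rw [Subsingleton.elim c c']
    exact .refl _
  refine ⟨tp (Set.range j) fun v => j (b 0 v), ⟨_, rfl, hinv _ _⟩, ?_,
    fun i v => j (b i v), fun i => ⟨?_, hinv _ _⟩, .refl _⟩
  · rintro φ ⟨hφ, hr⟩
    refine ⟨hφ.formula_relabel _, ?_⟩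
    rw [FirstOrder.Language.Formula.realize_relabel]
    have h1 := (hU.posEq_map hU' j _ φ hφ).1 hr
    convert h1 using 1
  · exact congrArg (fun b : V → U => tp (L := L) (Set.range j) fun v => j (b v)) (Subsingleton.elim (b i) (b 0))

end Morley

/-! ### Nodes, meets and cones -/

namespace Node

variable {α β : Ordinal.{u}}

theorem Le.refl (x : Node α) : Le x x := ⟨le_rfl, fun _ _ => rfl⟩

theorem Le.trans {x y z : Node α} (h : Le x y) (h' : Le y z) : Le x z :=
  ⟨h'.1.trans h.1, fun γ hγ => (h.2 γ hγ).trans (h'.2 γ (h.1.trans hγ))⟩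

theorem val_eq_zero_of_lt {x : Node α} {γ : Ordinal.{u}} (h : γ < x.level) : x.val γ = 0 := by
  by_contra hne
  exact absurd (x.mem_Ico γ hne).1 (not_le.2 h)

theorem val_eq_zero_of_ge {x : Node α} {γ : Ordinal.{u}} (h : α ≤ γ) : x.val γ = 0 := by
  by_contra hne
  exact absurd (x.mem_Ico γ hne).2 (not_lt.2 h)

theorem Le.antisymm {x y : Node α} (h : Le x y) (h' : Le y x) : x = y := by
  have hl : x.level = y.level := le_antisymm h'.1 h.1
  refine Node.ext hl (Finsupp.ext fun γ => ?_)
  rcases lt_or_ge γ x.level with hγ | hγ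
  · rw [val_eq_zero_of_lt hγ, val_eq_zero_of_lt (hl ▸ hγ)]
  · exact h.2 γ hγ

/-- The restrictions of a node form a chain. -/
theorem Le.of_level_le {x y z : Node α} (hx : Le x z) (hy : Le y z) (h : y.level ≤ x.level) :
    Le x y :=
  ⟨h, fun γ hγ => (hx.2 γ hγ).trans (hy.2 γ (h.trans hγ)).symm⟩

theorem meet_le_left (x y : Node α) : Le (meet x y) x := by
  classical
  refine ⟨(le_max_left _ _).trans (le_max_left _ _), fun γ hγ => ?_⟩
  exact Finsupp.filter_apply_pos _ _ hγ

theorem meet_le_right (x y : Node α) : Le (meet x y) y := by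
  classical
  refine ⟨(le_max_right _ _).trans (le_max_left _ _), fun γ hγ => ?_⟩
  refine (Finsupp.filter_apply_pos _ _ hγ).trans ?_
  by_contra hne
  have hmem : γ ∈ diffs x y := by
    simp only [diffs, Finset.mem_filter, Finset.mem_union, Finsupp.mem_support_iff]
    refine ⟨?_, (le_max_left _ _).trans hγ, hne⟩
    by_contra h
    push Not at h
    exact hne (h.1.trans h.2.symm)
  have h1 : Order.succ γ ≤ meetLevel x y :=
    (Finset.le_sup (f := Order.succ) hmem).trans (le_max_right _ _)
  exact absurd ((Order.lt_succ γ).trans_le (h1.trans hγ)) (lt_irrefl _)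

theorem le_meet {w x y : Node α} (hx : Le w x) (hy : Le w y) : Le w (meet x y) := by
  classical
  have hl : meetLevel x y ≤ w.level := by
    refine max_le (max_le hx.1 hy.1) (Finset.sup_le fun γ hγ => ?_)
    simp only [diffs, Finset.mem_filter] at hγ
    refine Order.succ_le_of_lt ?_
    by_contra h
    exact hγ.2.2 ((hx.2 γ (not_lt.1 h)).symm.trans (hy.2 γ (not_lt.1 h)))
  refine ⟨hl, fun γ hγ => (hx.2 γ hγ).trans ?_⟩
  exact (Finsupp.filter_apply_pos _ _ (hl.trans hγ)).symm

theorem meet_eq_of_forall {x y z : Node α} (hx : Le z x) (hy : Le z y)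
    (h : ∀ w, Le w x → Le w y → Le w z) : meet x y = z :=
  (h _ (meet_le_left x y) (meet_le_right x y)).antisymm (le_meet hx hy)

theorem meet_eq_left {x y : Node α} (h : Le x y) : meet x y = x :=
  meet_eq_of_forall (Le.refl x) h fun _ hw _ => hw

theorem meet_eq_right {x y : Node α} (h : Le y x) : meet x y = y :=
  meet_eq_of_forall h (Le.refl y) fun _ _ hw => hw

variable {η : Node α} (hη : η.level = Order.succ β)

theorem graft_val_of_lt (i : ℕ) (ξ : Node β) {γ : Ordinal.{u}} (h : γ < β) :
    (η.graft hη i ξ).val γ = ξ.val γ := by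
  have h1 : η.val γ = 0 := val_eq_zero_of_lt (hη ▸ h.trans (Order.lt_succ β))
  have h2 : β ≠ γ := h.ne'
  simp [graft, h1, h2]

theorem graft_val_self (i : ℕ) (ξ : Node β) : (η.graft hη i ξ).val β = i := by
  have h1 : η.val β = 0 := val_eq_zero_of_lt (hη ▸ Order.lt_succ β)
  have h2 : ξ.val β = 0 := val_eq_zero_of_ge le_rfl
  simp [graft, h1, h2]

theorem graft_val_of_gt (i : ℕ) (ξ : Node β) {γ : Ordinal.{u}} (h : β < γ) :
    (η.graft hη i ξ).val γ = η.val γ := by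
  have h1 : ξ.val γ = 0 := val_eq_zero_of_ge h.le
  have h2 : β ≠ γ := h.ne
  simp [graft, h1, h2]

theorem le_graft (i : ℕ) (ξ : Node β) : Le η (η.graft hη i ξ) := by
  refine ⟨?_, fun γ hγ => (graft_val_of_gt hη i ξ ?_).symm⟩
  · rw [hη]
    exact ξ.level_le.trans (Order.le_succ β)
  · rw [hη] at hγ
    exact (Order.lt_succ β).trans_le hγ

theorem graft_level_lt (i : ℕ) (ξ : Node β) : (η.graft hη i ξ).level < η.level := by
  rw [hη]
  exact ξ.level_le.trans_lt (Order.lt_succ β)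

theorem not_graft_le (i : ℕ) (ξ : Node β) : ¬ Le (η.graft hη i ξ) η :=
  fun h => absurd h.1 (not_le.2 (graft_level_lt hη i ξ))

theorem graft_le_graft_iff {i i' : ℕ} {ξ ξ' : Node β} :
    Le (η.graft hη i ξ) (η.graft hη i' ξ') ↔ i = i' ∧ Le ξ ξ' := by
  constructor
  · intro h
    refine ⟨?_, h.1, fun γ hγ => ?_⟩
    · have := h.2 β ξ.level_le
      rwa [graft_val_self, graft_val_self] at this
    · rcases lt_or_ge γ β with h1 | h1
      · have := h.2 γ hγ
        rwa [graft_val_of_lt hη _ _ h1, graft_val_of_lt hη _ _ h1] at this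
      · rw [val_eq_zero_of_ge h1, val_eq_zero_of_ge h1]
  · rintro ⟨rfl, h⟩
    refine ⟨h.1, fun γ hγ => ?_⟩
    rcases lt_trichotomy γ β with h1 | rfl | h1
    · rw [graft_val_of_lt hη _ _ h1, graft_val_of_lt hη _ _ h1]
      exact h.2 γ hγ
    · rw [graft_val_self, graft_val_self]
    · rw [graft_val_of_gt hη _ _ h1, graft_val_of_gt hη _ _ h1]

theorem graft_injective (i : ℕ) : Function.Injective (η.graft hη i) := fun x y h =>
  have h1 : Le (η.graft hη i x) (η.graft hη i y) := by rw [h]; exact .refl _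
  have h2 : Le (η.graft hη i y) (η.graft hη i x) := by rw [h]; exact .refl _
  ((graft_le_graft_iff hη).1 h1).2.antisymm ((graft_le_graft_iff hη).1 h2).2

/-- The nodes that properly extend `η` are of the form `η⌢⟨i⟩⌢ξ`. -/
theorem exists_eq_graft {y : Node α} (h : Le η y) (hy : y.level ≤ β) :
    ∃ ξ : Node β, y = η.graft hη (y.val β) ξ := by
  classical
  refine ⟨⟨y.level, y.val.filter (· < β), hy, y.not_limit, fun γ hγ => ?_⟩, ?_⟩
  · rw [Finsupp.filter_apply] at hγ
    split_ifs at hγ with h1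
    · exact ⟨(y.mem_Ico γ hγ).1, h1⟩
    · exact (hγ rfl).elim
  · refine Node.ext rfl (Finsupp.ext fun γ => ?_)
    rcases lt_trichotomy γ β with h1 | rfl | h1
    · rw [graft_val_of_lt hη _ _ h1]
      exact (Finsupp.filter_apply_pos (· < β) y.val h1).symm
    · rw [graft_val_self]
    · rw [graft_val_of_gt hη _ _ h1]
      exact (h.2 γ (hη ▸ Order.succ_le_of_lt h1)).symm

theorem meet_graft_same (i : ℕ) (ξ ξ' : Node β) :
    meet (η.graft hη i ξ) (η.graft hη i ξ') = η.graft hη i (meet ξ ξ') := by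
  refine meet_eq_of_forall ((graft_le_graft_iff hη).2 ⟨rfl, meet_le_left _ _⟩)
    ((graft_le_graft_iff hη).2 ⟨rfl, meet_le_right _ _⟩) fun w hw hw' => ?_
  rcases le_or_gt w.level β with h | h
  · have hηw : Le η w := (le_graft hη i ξ).of_level_le hw (hη ▸ h.trans (Order.le_succ β))
    obtain ⟨ζ, hζ⟩ := exists_eq_graft hη hηw h
    rw [hζ, graft_le_graft_iff] at hw hw' ⊢
    exact ⟨hw.1, le_meet hw.2 hw'.2⟩
  · exact (hw.of_level_le (le_graft hη i ξ) (hη ▸ Order.succ_le_of_lt h)).trans (le_graft hη i _)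

theorem meet_graft_of_ne {i i' : ℕ} (hi : i ≠ i') (ξ ξ' : Node β) :
    meet (η.graft hη i ξ) (η.graft hη i' ξ') = η := by
  refine meet_eq_of_forall (le_graft hη i ξ) (le_graft hη i' ξ') fun w hw hw' => ?_
  rcases le_or_gt w.level β with h | h
  · have h1 := hw.2 β h
    have h2 := hw'.2 β h
    rw [graft_val_self] at h1 h2
    exact absurd (h1.symm.trans h2) hi
  · exact hw.of_level_le (le_graft hη i ξ) (hη ▸ Order.succ_le_of_lt h)

/-- Distinct cones are ordered by their indices, and each cone is ordered as `𝒯_β`. -/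
theorem graft_lex_graft_iff {i i' : ℕ} {ξ ξ' : Node β} :
    Lex (η.graft hη i ξ) (η.graft hη i' ξ') ↔ i < i' ∨ (i = i' ∧ Lex ξ ξ') := by
  by_cases hi : i = i'
  · subst hi
    simp only [lt_irrefl, false_or, true_and]
    unfold Lex
    simp only [graft_le_graft_iff, true_and, meet_graft_same, (graft_injective hη i).ne_iff]
    refine or_congr_right (and_congr_right fun _ => and_congr_right fun _ => ?_)
    refine exists_congr fun γ => and_congr_right fun (hγ : (meet ξ ξ').level = Order.succ γ) => ?_
    have hγβ : γ < β := (Order.lt_succ γ).trans_le (hγ ▸ (meet ξ ξ').level_le)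
    rw [graft_val_of_lt hη _ _ hγβ, graft_val_of_lt hη _ _ hγβ]
  · unfold Lex
    simp only [graft_le_graft_iff, hi, Ne.symm hi, false_and, not_false_eq_true, true_and, false_or,
      or_false, meet_graft_of_ne hη hi, hη]
    constructor
    · rintro ⟨γ, hγ, h⟩
      obtain rfl := Order.succ_injective hγ
      rwa [graft_val_self, graft_val_self] at h
    · intro h
      exact ⟨β, rfl, by rwa [graft_val_self, graft_val_self]⟩

theorem lex_graft (i : ℕ) (ξ : Node β) : Lex η (η.graft hη i ξ) :=
  Or.inl ⟨le_graft hη i ξ, fun h => not_graft_le hη i ξ (h ▸ Le.refl _)⟩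

theorem not_graft_lex (i : ℕ) (ξ : Node β) : ¬ Lex (η.graft hη i ξ) η := by
  rintro (h | h)
  · exact not_graft_le hη i ξ h.1
  · exact h.2.1 (le_graft hη i ξ)

theorem not_lex_self (x : Node α) : ¬ Lex x x := by
  rintro (h | h)
  · exact h.2 rfl
  · exact h.1 (Le.refl x)

end Node

/-- The quantifier-free s-type of a tuple is determined by the levels, `⊴` and `<_lex` on its
closure under meets: `R` is the graph of an isomorphism between two meet-closed sets of nodes. -/
theorem eqQFType_sLang_of_rel {α : Ordinal.{u}} {R : Node α → Node α → Prop}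
    (hmeet : ∀ x y x' y', R x y → R x' y' → R (x.meet x') (y.meet y'))
    (hle : ∀ x y x' y', R x y → R x' y' → (x.Le x' ↔ y.Le y'))
    (hlex : ∀ x y x' y', R x y → R x' y' → (x.Lex x' ↔ y.Lex y'))
    (hlevel : ∀ x y, R x y → x.level = y.level)
    {n : ℕ} {s t : Fin n → Node α} (hst : ∀ i, R (s i) (t i)) : EqQFType (sLang α) s t := by
  have hterm : ∀ {V : Type} {a b : V → Node α}, (∀ i, R (a i) (b i)) →
      ∀ τ : (sLang α).Term V, R (τ.realize a) (τ.realize b) := by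
    intro V a b hab τ
    induction τ with
    | var i => exact hab i
    | func f ts ih =>
      cases f with
      | meet => exact hmeet _ _ _ _ (ih 0) (ih 1)
  have heq : ∀ x y x' y', R x y → R x' y' → (x = x' ↔ y = y') := by
    intro x y x' y' h h'
    constructor
    · rintro rfl
      exact ((hle _ _ _ _ h h').1 (.refl _)).antisymm ((hle _ _ _ _ h' h).1 (.refl _))
    · rintro rfl
      exact ((hle _ _ _ _ h h').2 (.refl _)).antisymm ((hle _ _ _ _ h' h).2 (.refl _))
  have key : ∀ {k : ℕ} (φ : (sLang α).BoundedFormula (Fin n) k), φ.IsQF →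
      ∀ xs ys : Fin k → Node α, (∀ i, R (xs i) (ys i)) → (φ.Realize s xs ↔ φ.Realize t ys) := by
    intro k φ hφ xs ys hxy
    have hR : ∀ z, R (Sum.elim s xs z) (Sum.elim t ys z) := by
      rintro (i | i)
      · exact hst i
      · exact hxy i
    induction hφ with
    | falsum => exact Iff.rfl
    | of_isAtomic h =>
      cases h with
      | equal t₁ t₂ => exact heq _ _ _ _ (hterm hR t₁) (hterm hR t₂)
      | rel r ts =>
        cases r with
        | le => exact hle _ _ _ _ (hterm hR (ts 0)) (hterm hR (ts 1))
        | lex => exact hlex _ _ _ _ (hterm hR (ts 0)) (hterm hR (ts 1))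
        | level γ =>
          have := hlevel _ _ (hterm hR (ts 0))
          exact iff_of_eq (congrArg (· = (γ : Ordinal.{u})) this)
    | imp _ _ ih₁ ih₂ => exact imp_congr ih₁ ih₂
  exact fun φ hφ => key φ hφ _ _ fun i => i.elim0

section StrType

variable {δ α : Ordinal.{u}} {n : ℕ} {s : Fin n → Node δ} {t : Fin n → Node α}

theorem EqQFType.le_iff (h : EqQFType strLang s t) (p q : Fin n) :
    (s p).Le (s q) ↔ (t p).Le (t q) :=
  h (FirstOrder.Language.Relations.formula (L := strLang) StrRel.le ![.var p, .var q])
    (FirstOrder.Language.BoundedFormula.IsAtomic.rel _ _).isQF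

theorem EqQFType.lex_iff (h : EqQFType strLang s t) (p q : Fin n) :
    (s p).Lex (s q) ↔ (t p).Lex (t q) :=
  h (FirstOrder.Language.Relations.formula (L := strLang) StrRel.lex ![.var p, .var q])
    (FirstOrder.Language.BoundedFormula.IsAtomic.rel _ _).isQF

theorem EqQFType.len_iff (h : EqQFType strLang s t) (p q : Fin n) :
    (s p).Len (s q) ↔ (t p).Len (t q) :=
  h (FirstOrder.Language.Relations.formula (L := strLang) StrRel.len ![.var p, .var q])
    (FirstOrder.Language.BoundedFormula.IsAtomic.rel _ _).isQF

theorem EqQFType.meet_eq_iff (h : EqQFType strLang s t) (p q r : Fin n) :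
    (s p).meet (s q) = s r ↔ (t p).meet (t q) = t r :=
  h (FirstOrder.Language.Term.equal
      (FirstOrder.Language.Term.func (L := strLang) TreeFunc.meet ![.var p, .var q]) (.var r))
    (FirstOrder.Language.BoundedFormula.IsAtomic.equal _ _).isQF

end StrType

/-! ### Cones of str-based trees -/

namespace Node

variable {α β : Ordinal.{u}}

/-- The family consisting of `η` and of the nodes `η⌢⟨i⟩⌢ξ`. -/
noncomputable def fan (η : Node α) (hη : η.level = Order.succ β) : Option (ℕ × Node β) → Node α
  | none => η
  | some p => η.graft hη p.1 p.2

theorem meet_val_lt {x y : Node α} {B : ℕ} (hB : 0 < B) (h : ∀ γ, x.val γ < B) (γ : Ordinal.{u}) :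
    (meet x y).val γ < B := by
  classical
  change (Finsupp.filter _ x.val) γ < B
  rw [Finsupp.filter_apply]
  split_ifs
  exacts [h γ, hB]

/-- If `β` is finite, then there are only finitely many nodes with bounded values. -/
theorem finite_setOf_val_lt (hβ : β < Ordinal.omega0) (B : ℕ) :
    {ξ : Node β | ∀ γ, ξ.val γ < B}.Finite := by
  obtain ⟨n, rfl⟩ := Ordinal.lt_omega0.1 hβ
  have hI : (Set.Iic (n : Ordinal.{u})).Finite := by
    refine ((Set.finite_Iic n).image (Nat.cast : ℕ → Ordinal.{u})).subset fun x hx => ?_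
    obtain ⟨m, rfl⟩ := Ordinal.lt_omega0.1 (lt_of_le_of_lt hx hβ)
    exact ⟨m, Nat.cast_le.1 (Set.mem_Iic.1 hx), rfl⟩
  have : Finite (Set.Iic (n : Ordinal.{u})) := hI
  refine Set.finite_coe_iff.1 (Finite.of_injective (β := Set.Iic (n : Ordinal.{u}) ×
    (Set.Iic (n : Ordinal.{u}) → Fin B))
    (fun ξ => (⟨ξ.1.level, ξ.1.level_le⟩, fun γ => ⟨ξ.1.val γ, ξ.2 γ⟩)) ?_)
  rintro ⟨ξ, hξ⟩ ⟨ζ, hζ⟩ h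
  simp only [Prod.mk.injEq] at h
  refine Subtype.ext (Node.ext (congrArg Subtype.val h.1) (Finsupp.ext fun γ => ?_))
  rcases le_or_gt γ (n : Ordinal.{u}) with hγ | hγ
  · exact congrArg Fin.val (congrFun h.2 ⟨γ, hγ⟩)
  · rw [val_eq_zero_of_ge hγ.le, val_eq_zero_of_ge hγ.le]

end Node

open Node

section Fan

variable {δ α β : Ordinal.{u}}

/-- If a tuple has the str-type of finitely many cones above a node `η`, cut down to a set `G` of
branches, then it has the s-type of such cones above a node `ν`.  The branches in all the cones are
taken from the first part of the tuple, which is legitimate since corresponding nodes have the same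
level. -/
theorem exists_fan_eqQFType {η : Node δ} (hη : η.level = Order.succ β) {G : Set (Node β)}
    (hG : G.Nonempty) (hmeet : ∀ ξ ∈ G, ∀ ζ ∈ G, meet ξ ζ ∈ G) {m : ℕ}
    (y : Option (Fin (m + 2) × G) → Node α) (e : Option (Fin (m + 2) × G) → Node δ)
    (he : ∀ p, e p = fan η hη (p.map (Prod.map Fin.val Subtype.val)))
    (hle : ∀ p q, Le (e p) (e q) ↔ Le (y p) (y q))
    (hlex : ∀ p q, Lex (e p) (e q) ↔ Lex (y p) (y q))
    (hlen : ∀ p q, Len (e p) (e q) ↔ Len (y p) (y q))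
    (hym : ∀ p q r, meet (e p) (e q) = e r ↔ meet (y p) (y q) = y r) :
    ∃ (γ : Ordinal.{u}) (hν : (y none).level = Order.succ γ) (τ : G → Node γ),
      ∀ (n : ℕ) (s : Fin n → Option (Fin (m + 2) × G)),
        EqQFType (sLang α) (fun i => y (s i))
          (fun i => fan (y none) hν ((s i).map (Prod.map Fin.val τ))) := by
  obtain ⟨ξ₀, hξ₀⟩ := hG
  have he0 : e none = η := he none
  have he1 : ∀ i ξ, e (some (i, ξ)) = η.graft hη i ξ := fun i ξ => he _
  -- the cones with indices `0` and `1` branch at the root, which has therefore a successor level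
  obtain ⟨γ, hν⟩ : ∃ γ, (y none).level = Order.succ γ := by
    have h01 : Lex (y (some (0, ⟨ξ₀, hξ₀⟩))) (y (some (1, ⟨ξ₀, hξ₀⟩))) := by
      rw [← hlex, he1, he1, graft_lex_graft_iff]
      exact Or.inl (by simp)
    have hnle : ¬ Le (y (some (0, ⟨ξ₀, hξ₀⟩))) (y (some (1, ⟨ξ₀, hξ₀⟩))) := by
      rw [← hle, he1, he1, graft_le_graft_iff]
      exact fun h => absurd h.1 (by simp)
    have hm : meet (y (some (0, ⟨ξ₀, hξ₀⟩))) (y (some (1, ⟨ξ₀, hξ₀⟩))) = y none := by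
      rw [← hym, he1, he1, he0]
      exact meet_graft_of_ne hη (by simp) _ _
    rcases h01 with h | ⟨-, -, γ, hγ, -⟩
    · exact absurd h.1 hnle
    · exact ⟨γ, by rw [← hm, hγ]⟩
  have hle0 : ∀ p, Le (y none) (y p) := by
    intro p
    rw [← hle, he0]
    rcases p with _ | ⟨i, ξ⟩
    · rw [he0]
      exact .refl _
    · rw [he1]
      exact le_graft hη _ _
  have hlevel : ∀ p, (y (some p)).level ≤ γ := by
    rintro ⟨i, ξ⟩
    have : Len (y none) (y (some (i, ξ))) := by
      rw [← hlen, he0, he1]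
      exact graft_level_lt hη _ _
    exact Order.lt_succ_iff.1 (hν ▸ this)
  choose τ hτ using fun ξ : G => exists_eq_graft hν (hle0 (some (0, ξ))) (hlevel (0, ξ))
  -- all the `y (some (0, ξ))` lie in the same cone above the root
  have hval : ∀ ξ ζ : G, Le (y (some (0, ξ))) (y (some (0, ζ))) →
      (y (some (0, ξ))).val γ = (y (some (0, ζ))).val γ := fun ξ ζ h => h.2 γ (hlevel _)
  have hconst : ∀ ξ ζ : G, (y (some (0, ξ))).val γ = (y (some (0, ζ))).val γ := by
    intro ξ ζ
    have h1 := hval ⟨meet ξ ζ, hmeet _ ξ.2 _ ζ.2⟩ ξ (by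
      rw [← hle, he1, he1, graft_le_graft_iff]
      exact ⟨rfl, meet_le_left _ _⟩)
    have h2 := hval ⟨meet ξ ζ, hmeet _ ξ.2 _ ζ.2⟩ ζ (by
      rw [← hle, he1, he1, graft_le_graft_iff]
      exact ⟨rfl, meet_le_right _ _⟩)
    exact h1.symm.trans h2
  obtain ⟨K, hK⟩ : ∃ K, ∀ ξ, y (some (0, ξ)) = (y none).graft hν K (τ ξ) :=
    ⟨(y (some (0, ⟨ξ₀, hξ₀⟩))).val γ, fun ξ => by rw [hconst _ ξ]; exact hτ ξ⟩
  have τle : ∀ ξ ζ : G, Le ξ.1 ζ ↔ Le (τ ξ) (τ ζ) := by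
    intro ξ ζ
    have := hle (some (0, ξ)) (some (0, ζ))
    rw [hK, hK, he1, he1, graft_le_graft_iff, graft_le_graft_iff] at this
    simpa using this
  have τlex : ∀ ξ ζ : G, Lex ξ.1 ζ ↔ Lex (τ ξ) (τ ζ) := by
    intro ξ ζ
    have := hlex (some (0, ξ)) (some (0, ζ))
    rw [hK, hK, he1, he1, graft_lex_graft_iff, graft_lex_graft_iff] at this
    simpa using this
  have τmeet : ∀ ξ ζ : G, meet (τ ξ) (τ ζ) = τ ⟨meet ξ ζ, hmeet _ ξ.2 _ ζ.2⟩ := by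
    intro ξ ζ
    have := (hym (some (0, ξ)) (some (0, ζ)) (some (0, ⟨meet ξ ζ, hmeet _ ξ.2 _ ζ.2⟩))).1 (by
      rw [he1, he1, he1, meet_graft_same])
    rw [hK, hK, hK, meet_graft_same] at this
    exact graft_injective hν K this
  have τlevel : ∀ i ξ, (y (some (i, ξ))).level = (τ ξ).level := by
    intro i ξ
    have h0 : (y (some (0, ξ))).level = (τ ξ).level := by
      rw [hK]
      rfl
    rw [← h0]
    refine le_antisymm (not_lt.1 fun h => ?_) (not_lt.1 fun h => ?_)
    · have h' := (hlen (some (i, ξ)) (some (0, ξ)))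
      rw [he1, he1] at h'
      exact lt_irrefl _ (h'.2 h)
    · have h' := (hlen (some (0, ξ)) (some (i, ξ)))
      rw [he1, he1] at h'
      exact lt_irrefl _ (h'.2 h)
  let z : Option (Fin (m + 2) × G) → Node α := fun p =>
    fan (y none) hν (p.map (Prod.map Fin.val τ))
  have hz0 : z none = y none := rfl
  have hz1 : ∀ i ξ, z (some (i, ξ)) = (y none).graft hν i (τ ξ) := fun _ _ => rfl
  have hmz : ∀ p q, ∃ r, meet (e p) (e q) = e r ∧ meet (z p) (z q) = z r := by
    rintro (_ | ⟨i, ξ⟩) q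
    · refine ⟨none, ?_, ?_⟩
      · have := hle0 q
        rw [← hle] at this
        exact meet_eq_left this
      · rcases q with _ | ⟨i, ξ⟩
        · exact meet_eq_left (.refl _)
        · exact meet_eq_left (le_graft hν _ _)
    · rcases q with _ | ⟨i', ξ'⟩
      · refine ⟨none, ?_, meet_eq_right (le_graft hν _ _)⟩
        rw [he0, he1]
        exact meet_eq_right (le_graft hη _ _)
      · by_cases hi : i = i'
        · subst hi
          refine ⟨some (i, ⟨meet ξ ξ', hmeet _ ξ.2 _ ξ'.2⟩), ?_, ?_⟩
          · rw [he1, he1, he1, meet_graft_same]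
          · rw [hz1, hz1, hz1, meet_graft_same, τmeet]
        · have hi' : (i : ℕ) ≠ i' := fun h => hi (Fin.ext h)
          refine ⟨none, ?_, meet_graft_of_ne hν hi' _ _⟩
          rw [he1, he1, he0]
          exact meet_graft_of_ne hη hi' _ _
  refine ⟨γ, hν, τ, fun n s => eqQFType_sLang_of_rel (R := fun x x' => ∃ p, x = y p ∧ x' = z p)
    ?_ ?_ ?_ ?_ fun i => ⟨s i, rfl, rfl⟩⟩
  · rintro _ _ _ _ ⟨p, rfl, rfl⟩ ⟨q, rfl, rfl⟩
    obtain ⟨r, hr, hr'⟩ := hmz p q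
    exact ⟨r, (hym p q r).1 hr, hr'⟩
  · rintro _ _ _ _ ⟨p, rfl, rfl⟩ ⟨q, rfl, rfl⟩
    rw [← hle]
    rcases p with _ | ⟨i, ξ⟩ <;> rcases q with _ | ⟨i', ξ'⟩
    · exact iff_of_true (.refl _) (.refl _)
    · rw [he0, he1, hz0, hz1]
      exact iff_of_true (le_graft hη _ _) (le_graft hν _ _)
    · rw [he0, he1, hz0, hz1]
      exact iff_of_false (not_graft_le hη _ _) (not_graft_le hν _ _)
    · rw [he1, he1, hz1, hz1, graft_le_graft_iff, graft_le_graft_iff, τle]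
  · rintro _ _ _ _ ⟨p, rfl, rfl⟩ ⟨q, rfl, rfl⟩
    rw [← hlex]
    rcases p with _ | ⟨i, ξ⟩ <;> rcases q with _ | ⟨i', ξ'⟩
    · exact iff_of_false (not_lex_self _) (not_lex_self _)
    · rw [he0, he1, hz0, hz1]
      exact iff_of_true (lex_graft hη _ _) (lex_graft hν _ _)
    · rw [he0, he1, hz0, hz1]
      exact iff_of_false (not_graft_lex hη _ _) (not_graft_lex hν _ _)
    · rw [he1, he1, hz1, hz1, graft_lex_graft_iff, graft_lex_graft_iff, τlex]
  · rintro _ _ ⟨p, rfl, rfl⟩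
    rcases p with _ | ⟨i, ξ⟩
    · rfl
    · exact τlevel i ξ

end Fan

section Trees

variable {L : FirstOrder.Language.{u, u}} {U U' : Type u} [L.Structure U] [L.Structure U']
  {X : Type u} {C : Set U} {α β : Ordinal.{u}}

/-- Every finite part of a sequence of cones of a tree that is str-based on an s-indiscernible tree
has the same type as a finite part of a sequence of cones of the latter tree. -/
theorem IsStrBased.exists_coneTuple {a : Node α → X → U} {b : Node Ordinal.omega0.{u} → X → U}
    (hb : IsStrBased L C b a) (ha : IsSIndiscernible L C a) (η : Node Ordinal.omega0.{u})
    (hη : η.level = Order.succ β) (N k : ℕ) (g : Fin k → Node β × X) :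
    ∃ (γ : Ordinal.{u}) (ν : Node α) (hν : ν.level = Order.succ γ) (h : Fin k → Node γ × X),
      PosEq L (Sum.elim (fun p : Fin N × Fin k => coneTuple a ν hν p.1 (h p.2))
          (Subtype.val : C → U))
        (Sum.elim (fun p : Fin N × Fin k => coneTuple b η hη p.1 (g p.2))
          (Subtype.val : C → U)) := by
  classical
  have hβ : β < Ordinal.omega0 := (Order.lt_succ β).trans_le (hη ▸ η.level_le)
  -- a bound for the values of the finitely many branches that occur
  obtain ⟨B, hB⟩ : ∃ B : ℕ, ∀ (t : Fin k) (γ : Ordinal.{u}), (g t).1.val γ < B := by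
    refine ⟨(Finset.univ.sup fun t : Fin k =>
      (g t).1.val.support.sup (g t).1.val) + 1, fun t γ => Nat.lt_succ_of_le ?_⟩
    by_cases hγ : (g t).1.val γ = 0
    · rw [hγ]
      exact Nat.zero_le _
    · exact (Finset.le_sup (f := (g t).1.val) (Finsupp.mem_support_iff.2 hγ)).trans
        (Finset.le_sup (f := fun t : Fin k => (g t).1.val.support.sup (g t).1.val)
          (Finset.mem_univ t))
  let G : Set (Node β) := {ξ | ∀ γ, ξ.val γ < B + 1}
  have hGf : Finite G := finite_setOf_val_lt hβ (B + 1)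
  have hG0 : (⟨0, 0, zero_le, Order.not_isSuccLimit_bot, fun γ h => (h rfl).elim⟩ : Node β) ∈ G :=
    fun γ => Nat.succ_pos B
  have hgG : ∀ t, (g t).1 ∈ G := fun t γ => (hB t γ).trans (Nat.lt_succ_self B)
  obtain ⟨K, ⟨ι⟩⟩ := Finite.exists_equiv_fin (Option (Fin (N + 2) × G))
  let e : Option (Fin (N + 2) × G) → Node Ordinal.omega0.{u} := fun p =>
    fan η hη (p.map (Prod.map Fin.val Subtype.val))
  obtain ⟨y, hy, hyt⟩ := hb K fun i => e (ι.symm i)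
  have hle := fun p q => hy.le_iff (ι p) (ι q)
  have hlex := fun p q => hy.lex_iff (ι p) (ι q)
  have hlen := fun p q => hy.len_iff (ι p) (ι q)
  have hmt := fun p q r => hy.meet_eq_iff (ι p) (ι q) (ι r)
  simp only [Equiv.symm_apply_apply] at hle hlex hlen hmt
  obtain ⟨γ, hν, τ, hτ⟩ := exists_fan_eqQFType hη ⟨_, hG0⟩
    (fun ξ hξ ζ _ => meet_val_lt (Nat.succ_pos B) hξ) (fun p => y (ι p)) e (fun _ => rfl)
    hle hlex hlen hmt
  refine ⟨γ, y (ι none), hν, fun t => (τ ⟨(g t).1, hgG t⟩, (g t).2), ?_⟩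
  have h1 := ha K _ _ (hτ K ι.symm)
  simp only [Equiv.apply_symm_apply] at h1
  have h2 := (eqType_iff_posEq.1 (hyt.trans h1)).comp (W := Fin N × Fin k ⊕ C)
    (Sum.map (fun p => (ι (some (Fin.castAdd 2 p.1, ⟨(g p.2).1, hgG p.2⟩)), (g p.2).2)) id)
  convert h2.symm using 1 <;> funext x <;> rcases x with x | x <;> simp [coneTuple, fan, e]

end Trees

end PosLogic

theorem mainTheorem12 {L : FirstOrder.Language.{u, u}} (T : L.Theory) (hT : PosLogic.IsPositiveTheory T)
    {U U' : Type u} [L.Structure U] [L.Structure U'] (κ κ' : Cardinal.{u})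
    (hU : PosLogic.IsMonster T U κ)
    (hU' : PosLogic.IsMonster T U' κ') (hUU' : #U < κ') (j : U →[L] U')
    (hthick : PosLogic.IsThick L U)
    (M : L.Substructure U) (hM : PosLogic.IsECModel T M) (hMκ : #M < κ)
    (X : Type u) (hX : #X < κ) (α : Ordinal.{u}) (hα : α.card < κ)
    (a : PosLogic.Node α → X → U) (b : PosLogic.Node Ordinal.omega0.{u} → X → U)
    (ha : PosLogic.IsSIndiscernible L (M : Set U) a)
    (ha' : PosLogic.IsSpreadOut j (M : Set U) a)
    (hb : PosLogic.IsStrBased L (M : Set U) b a) :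
    PosLogic.IsSpreadOut j (M : Set U) b := by
  intro β η hη
  rcases isEmpty_or_nonempty U with hUe | hUe
  · exact PosLogic.exists_isMorleySequence_of_isEmpty hU hU' (PosLogic.coneTuple b η hη)
  · refine PosLogic.LocallyMorley.exists_isMorleySequence
      (hU.locallyMorley_of_posEq hU' hUU' hMκ fun N k g => ?_) hU hU' hUU' hthick hMκ
    obtain ⟨γ, ν, hν, h, heq⟩ := hb.exists_coneTuple ha η hη N k g
    obtain ⟨q, -, -, hq⟩ := ha' γ ν hν
    exact ⟨_, q, _, h, hq, heq⟩
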